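/- **Setting.** Let $T=[0,\infty)$, let $Q$ be a finite set (of modes), and let $m,p\in\mathbb N$. $Q^*$ is the set of finite words over $Q$, $\epsilon$ the empty word, $Q^{\le L}$ the set of words of length at most $L$. $PC(T,\mathbb R^m)$ is the set of functions $u:T\to\mathbb R^m$ with finitely many discontinuities on each $[0,t]$ and finite one-sided limits at each of them. An input-output map is a map $f: PC(T,\mathbb R^m)\times (Q\times T)^+\to\mathbb R^p$, where $(Q\times T)^+$ is the set of non-empty finite sequences $(q_1,t_1)\cdots(q_k,t_k)$. Let $\Phi$ be a (possibly infinite) set of input-output maps which has a *generalized kernel representation*: there are analytic functions $K^{f}_w:T^{|w|}\to\mathbb R^p$ and $G_w:T^{|w|}\to\mathbb R^{p\times m}$ ($f\in\Phi$, $w\in Q^*\setminus\{\epsilon\}$) such that * $K^f_{wqqv}(\ldots,t,\hat t,\ldots)=K^f_{wqv}(\ldots,t+\hat t,\ldots)$ and $G_{wqqv}(\ldots,t,\hat t,\ldots)=G_{wqv}(\ldots,t+\hat t,\ldots)$ for $w,v\in Q^*$, $q\in Q$; * $K^f_{vqw}(\ldots,0,\ldots)=K^f_{vw}(\ldots)$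 if $w\ne\epsilon$ and $G_{vqw}(\ldots,0,\ldots)=G_{vw}(\ldots)$ if $v,w\neq\epsilon$, where the $0$ is the time of $q$; * $f(u,(q_1,t_1)\cdots(q_k,t_k))=K^f_{q_1\cdots q_k}(t_1,\ldots,t_k)+\sum_{i=1}^k\int_0^{t_i}G_{q_i\cdots q_k}(t_i-s,t_{i+1},\ldots,t_k)\,u\bigl(s+\sum_{j<i}t_j\bigr)\,ds$ for all $f\in\Phi$, all $u$ and all switching sequences. **Systems.** A linear switched system (LSS) $\Sigma$ of dimension $n\ge 0$ consists of matrices $A_q\in\mathbb R^{n\times n}$, $B_q\in\mathbb R^{n\times m}$, $C_q\in\mathbb R^{p\times n}$, $q\in Q$. For $x_0\in\mathbb R^n$, $u$, and $w=(q_1,t_1)\cdots(q_k,t_k)$, its output is $y_\Sigma(x_0,u,w)=C_{q_k}x$, where $x$ is the state reached from $x_0$ by solving successively $\dot x=A_{q_i}x+B_{q_i}u$ for time $t_i$, $i=1,\ldots,k$. An LSS realization is a pair $(\Sigma,\mu)$ with $\mu:\Phi\to\mathbb R^n$. It is a realization of $\Phi$ if $y_\Sigma(\mu(f),u,w)=f(u,w)$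 for all $f\in\Phi$, $u$, $w$, and a minimal one if moreover no realization of $\Phi$ has smaller dimension. Two LSS realizations are isomorphic if an invertible linear map between the state spaces carries the matrices $A_q,B_q,C_q$ and $\mu$ of one to those of the other. **Markov parameters.** For $w=q_1\cdots q_k\in Q^*$, $q,q_0\in Q$, $j\in\{1,\ldots,m\}$, $f\in\Phi$ put $$S_{f,q}(w)=\tfrac{d}{dt_1}\cdots\tfrac{d}{dt_k}f\bigl(0,(q_1,t_1)\cdots(q_k,t_k)(q,0)\bigr)\big|_{t=0},$$ $$S_{q,q_0,j}(w)=\tfrac{d}{dt_0}\cdots\tfrac{d}{dt_k}\Bigl[f\bigl(e_j,(q_0,t_0)\cdots(q_k,t_k)(q,0)\bigr)-f\bigl(0,(q_0,t_0)\cdots(q_k,t_k)(q,0)\bigr)\Bigr]\Big|_{t=0},$$ where $e_j$ and $0$ denote constant inputs; the second does not depend on the choice of $f\in\Phi$ (and is taken to be $0$ if $\Phi=\emptyset$). $(\Sigma,\mu)$ is an *$M$-partial realization* of $\Phi$ if $S_{q,q_0,j}(w)=C_qA_{q_k}\cdots A_{q_1}B_{q_0}e_j$ and $S_{f,q}(w)=C_qA_{q_k}\cdots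 A_{q_1}\mu(f)$ for all $q,q_0,j,f$ and all words $w=q_1\cdots q_k$ with $k\le M$; it is a minimal one if moreover no $M$-partial realization has smaller dimension. **Hankel matrices.** Let $J_\Phi=\Phi\sqcup(Q\times\{1,\ldots,m\})$. The Hankel matrix $H_\Phi$ has rows indexed by $(v,(q,i))$ with $v\in Q^*$, $q\in Q$, $1\le i\le p$, columns indexed by $(w,j)\in Q^*\times J_\Phi$, and the entry there is the $i$th coordinate of $S_{f,q}(wv)$ if $j=f\in\Phi$ and of $S_{q,q_0,z}(wv)$ if $j=(q_0,z)$. $H_{\Phi,L,M}$ is the submatrix with $v\in Q^{\le L}$, $w\in Q^{\le M}$. The rank, in $\mathbb N\cup\{\infty\}$, is the dimension of the span of the columns. **Algorithm 1.** Choose a linear isomorphism $S$ from the column space of $H_{\Phi,N,N+1}$ to $\mathbb R^n$, $n=\operatorname{rank}H_{\Phi,N,N+1}$; let $\mathbf C_{w,j}$ be the column of $H_{\Phi,N,N+1}$ indexed by $(w,j)$. Return the $(\Sigma_N,\mu_N)$ of dimension $n$ such that the $j$th column of $B_q$ is $S(\mathbf C_{\epsilon,(q,j)})$, $\mu_N(f)=S(\mathbf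 C_{\epsilon,f})$, $C_qS(\mathbf C_{w,j})=\bigl((\mathbf C_{w,j})_{(\epsilon,(q,i))}\bigr)_{i=1}^p$ for $w\in Q^{\le N+1}$, $j\in J_\Phi$, and $S^{-1}A_qS(\mathbf C_{w,j})=\mathbf C_{wq,j}$ for $w\in Q^{\le N}$, $j\in J_\Phi$; abort if there is no such $A_q$. **Algorithm 2.** Choose a factorization $H_{\Phi,N+1,N}=OR$ with $O$ having $r$ columns, $R$ having $r$ rows and $r=\operatorname{rank}O=\operatorname{rank}R=\operatorname{rank}H_{\Phi,N+1,N}$. The $i$th row of $\widetilde C_q$ is the row $(\epsilon,(q,i))$ of $O$; the $j$th column of $\widetilde B_q$ is the column $(\epsilon,(q,j))$ of $R$; $\widetilde\mu_N(f)$ is the column $(\epsilon,f)$ of $R$. Let $\bar\Gamma$ be the submatrix of $O$ of the rows indexed by words in $Q^{\le N}$, and let $\bar\Gamma_q$ have as its row $(v,i)$, $v\in Q^{\le N}$, the row $(qv,i)$ of $O$. If for every $q\in Q$ the equation $\bar\Gamma\widetilde A_q=\bar\Gamma_q$ has a unique solution $\widetilde A_q\in\mathbb R^{r\times r}$, return $(\widetilde\Sigma_N,\widetilde\mu_N)$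 with $\widetilde\Sigma_N=(\widetilde A_q,\widetilde B_q,\widetilde C_q)_{q\in Q}$; otherwise return "NoRealization". **Theorem.** Let $N>0$. A factorization as required in Algorithm 2 and an isomorphism as required in Algorithm 1 exist, and the following hold. 1. Assume $$\operatorname{rank}H_{\Phi,N,N}=\operatorname{rank}H_{\Phi,N+1,N}=\operatorname{rank}H_{\Phi,N,N+1}.\qquad(*)$$ Then Algorithm 2, for every choice of the factorization, returns an LSS realization $(\widetilde\Sigma_N,\widetilde\mu_N)$, and this is a minimal $(2N+1)$-partial realization of $\Phi$. Moreover Algorithm 1, for every choice of the isomorphism, returns an LSS realization $(\Sigma_N,\mu_N)$, and $(\widetilde\Sigma_N,\widetilde\mu_N)$ is isomorphic to it. 2. If $\operatorname{rank}H_{\Phi,N,N}=\operatorname{rank}H_\Phi$, then $(*)$ holds and Algorithm 2, for every choice of the factorization, returns a minimal realization of $\Phi$. If there is a realization $(\Sigma,\mu)$ of $\Phi$ with $\dim\Sigma\le N+1$, then $\operatorname{rank}H_{\Phi,N,N}=\operatorname{rank}H_\Phi$ and Algorithm 2 returns a minimal realization of $\Phi$. -/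

import Mathlib

open Set Filter Topology
open scoped NNReal Matrix

namespace LinSwitch

/-! ### Inputs, switching sequences and input-output maps; the time axis is `ℝ≥0` -/

/-- Finitely many discontinuities on each `[0, T]`, with finite one-sided limits at each of them
(at `0` the filter `𝓝[<] 0` on `ℝ≥0` is trivial, so only the right limit is required there). -/
def IsPiecewiseContinuous {m : ℕ} (u : ℝ≥0 → (Fin m → ℝ)) : Prop :=
  (∀ T : ℝ≥0, {t : ℝ≥0 | t ≤ T ∧ ¬ ContinuousAt u t}.Finite) ∧
  ∀ t : ℝ≥0, ¬ ContinuousAt u t →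
    (∃ l : Fin m → ℝ, Tendsto u (𝓝[<] t) (𝓝 l)) ∧ (∃ l : Fin m → ℝ, Tendsto u (𝓝[>] t) (𝓝 l))

/-- Piecewise-continuous inputs `PC(T, ℝ^m)`. -/
def PC (m : ℕ) : Type := {u : ℝ≥0 → (Fin m → ℝ) // IsPiecewiseContinuous u}

theorem isPiecewiseContinuous_const {m : ℕ} (a : Fin m → ℝ) :
    IsPiecewiseContinuous (fun _ : ℝ≥0 => a) := by
  refine ⟨fun T => ?_, fun t ht => absurd continuousAt_const ht⟩
  convert Set.finite_empty
  ext t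
  simp [continuousAt_const]

/-- The constant input with value `a`. -/
def PC.const {m : ℕ} (a : Fin m → ℝ) : PC m := ⟨fun _ => a, isPiecewiseContinuous_const a⟩

/-- Non-empty switching sequences `(q₁,t₁)⋯(q_k,t_k)`, where `t_i` is the time spent in `q_i`. -/
def SwitchSeq (Q : Type*) : Type _ := {w : List (Q × ℝ≥0) // w ≠ []}

/-- Input-output maps `PC(T, ℝ^m) × (Q × T)⁺ → ℝ^p`. -/
abbrev IOMap (Q : Type*) (m p : ℕ) : Type _ := PC m → SwitchSeq Q → (Fin p → ℝ)

/-- The list `(q₁,t₁)⋯(q_k,t_k)` for a word `w = q₁⋯q_k` and times `t`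
(used only for `t_i ≥ 0`). -/
noncomputable def timed {Q : Type*} (w : List Q) (t : Fin w.length → ℝ) : List (Q × ℝ≥0) :=
  List.ofFn fun i => (w.get i, (t i).toNNReal)

/-! ### Generalized kernel representations -/

/-- A family of functions `K_w : T^{|w|} → ℝ^p`, `w ∈ Q⁺`, is encoded as one function on switching
sequences, `K_{q₁⋯q_k}(t₁,…,t_k) = K ((q₁,t₁)⋯(q_k,t_k))`; likewise for `G`. Values on the empty
list are irrelevant. -/
def HasKernelRepresentation {Q : Type*} {m p : ℕ} (Φ : Set (IOMap Q m p)) : Prop :=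
  ∃ (K : Φ → List (Q × ℝ≥0) → (Fin p → ℝ)) (G : List (Q × ℝ≥0) → Matrix (Fin p) (Fin m) ℝ),
    -- analyticity on the orthants `T^k`
    (∀ (f : Φ) (w : List Q), w ≠ [] →
      AnalyticOn ℝ (fun t : Fin w.length → ℝ => K f (timed w t)) (Ici 0)) ∧
    (∀ (w : List Q), w ≠ [] → ∀ (i : Fin p) (j : Fin m),
      AnalyticOn ℝ (fun t : Fin w.length → ℝ => G (timed w t) i j) (Ici 0)) ∧
    -- two consecutive stays in the same mode can be merged
    (∀ (f : Φ) (w v : List (Q × ℝ≥0)) (q : Q) (t t' : ℝ≥0),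
      K f (w ++ (q, t) :: (q, t') :: v) = K f (w ++ (q, t + t') :: v)) ∧
    (∀ (w v : List (Q × ℝ≥0)) (q : Q) (t t' : ℝ≥0),
      G (w ++ (q, t) :: (q, t') :: v) = G (w ++ (q, t + t') :: v)) ∧
    -- a stay of length zero can be deleted
    (∀ (f : Φ) (v w : List (Q × ℝ≥0)) (q : Q), w ≠ [] →
      K f (v ++ (q, 0) :: w) = K f (v ++ w)) ∧
    (∀ (v w : List (Q × ℝ≥0)) (q : Q), v ≠ [] → w ≠ [] →
      G (v ++ (q, 0) :: w) = G (v ++ w)) ∧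
    -- the input-output maps are given by the kernels
    (∀ (f : Φ) (u : PC m) (w : SwitchSeq Q),
      f.1 u w = K f w.1 + ∑ i : Fin w.1.length,
        ∫ s in (0 : ℝ)..((w.1.get i).2 : ℝ),
          G (((w.1.get i).1, (((w.1.get i).2 : ℝ) - s).toNNReal) :: w.1.drop (i + 1)) *ᵥ
            u.1 (s.toNNReal + ((w.1.take i).map Prod.snd).sum))

/-! ### Markov parameters -/

/-- `d/dt₁ d/dt₂ ⋯ d/dt_k g(t₁,…,t_k)` at `t = 0`, with (one-sided) derivatives along `[0,∞)`. -/
noncomputable def mixedDeriv {E : Type*} [NormedAddCommGroup E] [NormedSpace ℝ E] :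
    (k : ℕ) → ((Fin k → ℝ) → E) → E
  | 0, g => g Fin.elim0
  | k + 1, g => derivWithin (fun t : ℝ => mixedDeriv k fun s => g (Fin.cons t s)) (Ici 0) 0

/-- `f_{u,wq}(t₁,…,t_k,0)` for `w = q₁⋯q_k`. -/
noncomputable def alongWord {Q : Type*} {m p : ℕ} (f : IOMap Q m p) (u : PC m) (w : List Q) (q : Q)
    (t : Fin w.length → ℝ) : Fin p → ℝ :=
  f u ⟨timed w t ++ [(q, 0)], by simp⟩

/-- `S_{f,q}(w)`. -/
noncomputable def markovInit {Q : Type*} {m p : ℕ} (f : IOMap Q m p) (q : Q) (w : List Q) :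
    Fin p → ℝ :=
  mixedDeriv w.length (alongWord f (PC.const 0) w q)

/-- The expression defining `S_{q,q₀,j}(w)`, evaluated on the input-output map `f`. -/
noncomputable def markovInputOf {Q : Type*} {m p : ℕ} (f : IOMap Q m p) (q q₀ : Q) (j : Fin m)
    (w : List Q) : Fin p → ℝ :=
  mixedDeriv (q₀ :: w).length (alongWord f (PC.const (Pi.single j 1)) (q₀ :: w) q) -
    mixedDeriv (q₀ :: w).length (alongWord f (PC.const 0) (q₀ :: w) q)

open Classical in
/-- `S_{q,q₀,j}(w)`, computed on an arbitrary element of `Φ`; all elements give the same value if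
`Φ` has a generalized kernel representation. For `Φ = ∅` it is `0` by convention. -/
noncomputable def markovInput {Q : Type*} {m p : ℕ} (Φ : Set (IOMap Q m p)) (q q₀ : Q) (j : Fin m)
    (w : List Q) : Fin p → ℝ :=
  if h : Φ.Nonempty then markovInputOf h.some q q₀ j w else 0

/-! ### Hankel matrices; their rank is `Matrix.eRank`, the dimension in `ℕ∞` of the column span -/

/-- `J_Φ = Φ ∪ (Q × {1,…,m})`. -/
abbrev ColIdx {Q : Type*} {m p : ℕ} (Φ : Set (IOMap Q m p)) : Type _ := Φ ⊕ (Q × Fin m)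

/-- `Q^{≤ L}`. -/
abbrev Words (Q : Type*) (L : ℕ) : Type _ := {w : List Q // w.length ≤ L}

/-- The Hankel matrix. The row index `i = pK + r + 1 ∈ {1,…,p|Q|}` attached to an enumeration
`σ₁, σ₂, …` of `Q` is written as the pair `(σ_{K+1}, r) ∈ Q × Fin p`. -/
noncomputable def hankel {Q : Type*} {m p : ℕ} (Φ : Set (IOMap Q m p)) :
    Matrix (List Q × (Q × Fin p)) (List Q × ColIdx Φ) ℝ :=
  fun v w =>
    match w.2 with
    | Sum.inl f => markovInit f.1 v.2.1 (w.1 ++ v.1) v.2.2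
    | Sum.inr j => markovInput Φ v.2.1 j.1 j.2 (w.1 ++ v.1) v.2.2

/-- `H_{Φ,L,M}`. -/
noncomputable def hankelSub {Q : Type*} {m p : ℕ} (Φ : Set (IOMap Q m p)) (L M : ℕ) :
    Matrix (Words Q L × (Q × Fin p)) (Words Q M × ColIdx Φ) ℝ :=
  (hankel Φ).submatrix (Prod.map Subtype.val id) (Prod.map Subtype.val id)

/-- `rank H_{Φ,N,N} = rank H_{Φ,N+1,N} = rank H_{Φ,N,N+1}`. -/
def RankCondition {Q : Type*} {m p : ℕ} (Φ : Set (IOMap Q m p)) (N : ℕ) : Prop :=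
  (hankelSub Φ N N).eRank = (hankelSub Φ (N + 1) N).eRank ∧
    (hankelSub Φ (N + 1) N).eRank = (hankelSub Φ N (N + 1)).eRank

/-! ### Linear switched systems and realizations -/

/-- Linear switched systems with state space `ℝ^n`, inputs `ℝ^m`, outputs `ℝ^p`, modes `Q`. -/
structure LSS (Q : Type*) (n m p : ℕ) where
  A : Q → Matrix (Fin n) (Fin n) ℝ
  B : Q → Matrix (Fin n) (Fin m) ℝ
  C : Q → Matrix (Fin p) (Fin n) ℝ

/-- `x` solves `ẋ = A x + B v` on `[0, t]`: it is continuous there and satisfies the equation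
at all interior times at which the (piecewise-continuous) input `v` is continuous. -/
def IsSolution {n m : ℕ} (A : Matrix (Fin n) (Fin n) ℝ) (B : Matrix (Fin n) (Fin m) ℝ)
    (v : ℝ → Fin m → ℝ) (t : ℝ) (x : ℝ → Fin n → ℝ) : Prop :=
  ContinuousOn x (Icc 0 t) ∧
    ∀ s ∈ Ioo 0 t, ContinuousAt v s → HasDerivAt x (A *ᵥ x s + B *ᵥ v s) s

/-- `Σ.IsState u τ x₀ w x`: started at time `τ` in `x₀` and fed with `u` and the switching sequence
`w`, the system ends up in `x`. -/
def LSS.IsState {Q : Type*} {n m p : ℕ} (sys : LSS Q n m p) (u : PC m) :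
    ℝ≥0 → (Fin n → ℝ) → List (Q × ℝ≥0) → (Fin n → ℝ) → Prop
  | _, x₀, [], x => x = x₀
  | τ, x₀, (q, t) :: w, x =>
      ∃ ξ : ℝ → Fin n → ℝ, ξ 0 = x₀ ∧
        IsSolution (sys.A q) (sys.B q) (fun s => u.1 (s.toNNReal + τ)) t ξ ∧
        sys.IsState u (τ + t) (ξ t) w x

/-- `y = y_Σ(x₀, u, w)`. -/
def LSS.IsOutput {Q : Type*} {n m p : ℕ} (sys : LSS Q n m p) (x₀ : Fin n → ℝ) (u : PC m)
    (w : SwitchSeq Q) (y : Fin p → ℝ) : Prop :=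
  ∃ x : Fin n → ℝ, sys.IsState u 0 x₀ w.1 x ∧ y = sys.C (w.1.getLast w.2).1 *ᵥ x

/-- `A_{q_k} ⋯ A_{q_1}` for the word `q₁⋯q_k`. -/
def LSS.prodA {Q : Type*} {n m p : ℕ} (sys : LSS Q n m p) : List Q → Matrix (Fin n) (Fin n) ℝ
  | [] => 1
  | q :: w => sys.prodA w * sys.A q

/-- Pairs `(Σ, μ)` with `dim Σ = n` and `μ : Φ → ℝ^n`. -/
structure Realization {Q : Type*} {m p : ℕ} (Φ : Set (IOMap Q m p)) (n : ℕ) where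
  sys : LSS Q n m p
  μ : Φ → (Fin n → ℝ)

namespace Realization

variable {Q : Type*} {m p : ℕ} {Φ : Set (IOMap Q m p)} {n n' : ℕ}

/-- `(Σ, μ)` is a realization of `Φ`. -/
def IsRealization (R : Realization Φ n) : Prop :=
  ∀ (f : Φ) (u : PC m) (w : SwitchSeq Q), R.sys.IsOutput (R.μ f) u w (f.1 u w)

/-- `(Σ, μ)` is a minimal realization of `Φ`. -/
def IsMinimalRealization (R : Realization Φ n) : Prop :=
  R.IsRealization ∧ ∀ (k : ℕ) (R' : Realization Φ k), R'.IsRealization → n ≤ k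

/-- `(Σ, μ)` is an `N`-partial realization of `Φ`. -/
def IsPartialRealization (N : ℕ) (R : Realization Φ n) : Prop :=
  ∀ (q : Q) (w : List Q), w.length ≤ N →
    (∀ (q₀ : Q) (j : Fin m), markovInput Φ q q₀ j w =
      (R.sys.C q * R.sys.prodA w * R.sys.B q₀) *ᵥ Pi.single j 1) ∧
    (∀ f : Φ, markovInit f.1 q w = (R.sys.C q * R.sys.prodA w) *ᵥ R.μ f)

/-- `(Σ, μ)` is a minimal `N`-partial realization of `Φ`. -/
def IsMinimalPartialRealization (N : ℕ) (R : Realization Φ n) : Prop :=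
  R.IsPartialRealization N ∧
    ∀ (k : ℕ) (R' : Realization Φ k), R'.IsPartialRealization N → n ≤ k

/-- Existence of an isomorphism of realizations. -/
def Isomorphic (R : Realization Φ n) (R' : Realization Φ n') : Prop :=
  ∃ S : (Fin n → ℝ) ≃ₗ[ℝ] (Fin n' → ℝ),
    (∀ q x, R'.sys.A q *ᵥ S x = S (R.sys.A q *ᵥ x)) ∧
    (∀ q v, R'.sys.B q *ᵥ v = S (R.sys.B q *ᵥ v)) ∧
    (∀ q x, R'.sys.C q *ᵥ S x = R.sys.C q *ᵥ x) ∧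
    (∀ f, S (R.μ f) = R'.μ f)

end Realization

/-! ### The column-space algorithm -/

section ColumnSpaceAlgorithm

variable {Q : Type*} {m p : ℕ} (Φ : Set (IOMap Q m p)) (N : ℕ)

/-- The column space of `H_{Φ,N,N+1}`. -/
noncomputable def colSpace : Submodule ℝ (Words Q N × (Q × Fin p) → ℝ) :=
  Submodule.span ℝ (Set.range (hankelSub Φ N (N + 1)).col)

/-- The column of `H_{Φ,N,N+1}` indexed by `(w, j)`, as an element of the column space. -/
noncomputable def column (w : Words Q (N + 1)) (j : ColIdx Φ) : colSpace Φ N :=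
  ⟨(hankelSub Φ N (N + 1)).col (w, j), Submodule.subset_span ⟨(w, j), rfl⟩⟩

/-- `R` is returned by the algorithm which is run with the isomorphism `S` from the column space
of `H_{Φ,N,N+1}` to `ℝ^n`. -/
def IsColumnSpaceOutput {n : ℕ} (S : colSpace Φ N ≃ₗ[ℝ] (Fin n → ℝ)) (R : Realization Φ n) :
    Prop :=
  (∀ (q : Q) (j : Fin m), (R.sys.B q).col j = S (column Φ N ⟨[], by simp⟩ (Sum.inr (q, j)))) ∧
  (∀ (q : Q) (w : Words Q (N + 1)) (j : ColIdx Φ), R.sys.C q *ᵥ S (column Φ N w j) =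
    fun i => hankelSub Φ N (N + 1) (⟨[], by simp⟩, (q, i)) (w, j)) ∧
  (∀ (q : Q) (w : Words Q N) (j : ColIdx Φ),
    S.symm (R.sys.A q *ᵥ S (column Φ N ⟨w.1, w.2.trans (Nat.le_succ N)⟩ j)) =
      column Φ N ⟨w.1 ++ [q], by simpa using w.2⟩ j) ∧
  (∀ f : Φ, R.μ f = S (column Φ N ⟨[], by simp⟩ (Sum.inl f)))

end ColumnSpaceAlgorithm

/-! ### The factorization (Kalman–Ho-like) algorithm -/

section FactorizationAlgorithm

variable {Q : Type*} {m p : ℕ} {Φ : Set (IOMap Q m p)} {N r : ℕ}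

/-- `H_{Φ,N+1,N} = O R` with `r = rank R = rank O = rank H_{Φ,N+1,N}`. -/
def IsFullRankFactorization (O : Matrix (Words Q (N + 1) × (Q × Fin p)) (Fin r) ℝ)
    (R : Matrix (Fin r) (Words Q N × ColIdx Φ) ℝ) : Prop :=
  hankelSub Φ (N + 1) N = O * R ∧ R.eRank = r ∧ O.eRank = r ∧
    (hankelSub Φ (N + 1) N).eRank = r

/-- `Γ̄`: the rows of `O` indexed by words of length at most `N`. -/
def gammaBar (O : Matrix (Words Q (N + 1) × (Q × Fin p)) (Fin r) ℝ) :
    Matrix (Words Q N × (Q × Fin p)) (Fin r) ℝ :=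
  fun v k => O (⟨v.1.1, v.1.2.trans (Nat.le_succ N)⟩, v.2) k

/-- `Γ̄_q`: the row indexed by `(v, i)` is the row `(qv, i)` of `O`. -/
def gammaShift (O : Matrix (Words Q (N + 1) × (Q × Fin p)) (Fin r) ℝ) (q : Q) :
    Matrix (Words Q N × (Q × Fin p)) (Fin r) ℝ :=
  fun v k => O (⟨q :: v.1.1, by simpa using v.1.2⟩, v.2) k

open Classical in
/-- The algorithm run with the factorization `H_{Φ,N+1,N} = O R`; `none` stands for
`NoRealization`. -/
noncomputable def factorizationAlgorithm
    (O : Matrix (Words Q (N + 1) × (Q × Fin p)) (Fin r) ℝ)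
    (R : Matrix (Fin r) (Words Q N × ColIdx Φ) ℝ) : Option (Realization Φ r) :=
  if h : ∀ q : Q, ∃! A : Matrix (Fin r) (Fin r) ℝ, gammaBar O * A = gammaShift O q then
    some
      { sys :=
          { A := fun q => (h q).choose
            B := fun q => Matrix.of fun k j => R k (⟨[], by simp⟩, Sum.inr (q, j))
            C := fun q => Matrix.of fun i k => O (⟨[], by simp⟩, (q, i)) k }
        μ := fun f k => R k (⟨[], by simp⟩, Sum.inl f) }
  else none

end FactorizationAlgorithm

end LinSwitch

/-
For a realization of dimension `n`, let the observability map truncated at `L` send a state `x` to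
the family `C_q A_v x`, `v ∈ Q^{≤L}`, and call `A_w μ(f)` and `A_w B_{q₀} e_z` the reachability
vectors. An `(L + M)`-partial realization factors `H_{Φ,L,M}` through these. So no
`(2N + 1)`-partial realization has dimension below `rank H_{Φ,N,N}`; if its dimension equals this
rank, the truncated observability map is an isomorphism of `ℝⁿ` onto the column space of
`H_{Φ,N,N+1}`, which carries its matrices to the ones prescribed by Algorithm 1.

For a full-rank factorization `H_{Φ,N+1,N} = O R` the product `Γ̄ R` is `H_{Φ,N,N}`, so the rank
condition makes `Γ̄` injective. The columns of `Γ̄_q R` are columns of `H_{Φ,N,N+1}`, hence lie in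
the span of those of `H_{Φ,N,N}`, the range of `Γ̄`. So `Γ̄ Ã_q = Γ̄_q` is uniquely solvable, and by
induction on words `O` and `R` consist of the rows `C_q A_v` and of the reachability vectors.

If `rank H_{Φ,N,N} = rank H_Φ`, the restriction of the column space of `H_Φ` to the rows of
`H_{Φ,N,N}` is injective. Its inverse is compatible with the shift by a letter, so the partial
realization reproduces all Markov parameters. These are iterated one-sided derivatives at `0` of
analytic kernels, in which repeated letters can be merged; hence they contain all mixed derivatives
of the kernels at `0` and determine the input-output maps by the identity theorem.

Finally, reachability vectors of words of length at most `L` span increasing subspaces of `ℝⁿ` which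
are stationary as soon as two consecutive ones agree, hence from `L = n - 1` on, and dually for
observability; so `rank H_{Φ,N,N} = rank H_Φ` if there is a realization of dimension `n ≤ N + 1`.
-/

namespace LinSwitch

/-! ### Ranks of matrices with infinitely many rows or columns -/

section Rank

open Submodule (span)
open Module (finrank)

variable {K I J k : Type*} [Field K]

theorem finiteDimensional_span_col_of_eRank_eq {A : Matrix I J K} {r : ℕ} (h : A.eRank = r) :
    FiniteDimensional K (span K (range A.col)) :=
  Module.rank_lt_aleph0_iff.1 <| Cardinal.toENat_lt_top.1 <| h.trans_lt (ENat.natCast_lt_top r)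

theorem eRank_eq_finrank (A : Matrix I J K) [FiniteDimensional K (span K (range A.col))] :
    A.eRank = finrank K (span K (range A.col)) := by
  rw [Matrix.eRank, Matrix.cRank, ← Module.finrank_eq_rank, Cardinal.toENat_nat]

theorem finrank_span_col_of_eRank_eq {A : Matrix I J K} {r : ℕ} (h : A.eRank = r) :
    finrank K (span K (range A.col)) = r := by
  rw [← Matrix.eRank_toNat_eq_finrank, h, ENat.toNat_natCast]

theorem eRank_le_finrank_of_col_mem_range {V : Type*} [AddCommGroup V] [Module K V]
    [FiniteDimensional K V] {A : Matrix I J K} (T : V →ₗ[K] I → K)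
    (h : ∀ c, A.col c ∈ LinearMap.range T) : A.eRank ≤ finrank K V := by
  have hle : span K (range A.col) ≤ LinearMap.range T :=
    Submodule.span_le.2 (range_subset_iff.2 h)
  have := Submodule.finiteDimensional_of_le hle
  rw [eRank_eq_finrank]
  exact_mod_cast (Submodule.finrank_mono hle).trans T.finrank_range_le

theorem eRank_eq_of_span_col_eq_map {I' J' : Type*} {A : Matrix I J K} {B : Matrix I' J' K}
    {f : (I → K) →ₗ[K] I' → K} (hf : InjOn f (span K (range A.col)))
    (h : span K (range B.col) = (span K (range A.col)).map f) : B.eRank = A.eRank := by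
  rw [Matrix.eRank, Matrix.cRank, h, Matrix.eRank, Matrix.cRank, ← LinearMap.range_domRestrict]
  simpa using (congrArg Cardinal.toENat
    (LinearEquiv.ofInjective (f.domRestrict _) (injOn_iff_injective.1 hf)).lift_rank_eq).symm

theorem injOn_of_finrank_le_finrank_map {V W : Type*} [AddCommGroup V] [Module K V]
    [AddCommGroup W] [Module K W] {f : V →ₗ[K] W} {Y : Submodule K V} [FiniteDimensional K Y]
    (h : finrank K Y ≤ finrank K (Y.map f)) : InjOn f Y := by
  have hker := (f.domRestrict Y).finrank_range_add_finrank_ker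
  rw [LinearMap.range_domRestrict] at hker
  have hbot : LinearMap.ker (f.domRestrict Y) = ⊥ := Submodule.finrank_eq_zero.1 (by omega)
  exact injOn_iff_injective.2 (LinearMap.ker_eq_bot.1 hbot)

theorem span_col_mul [Fintype k] (A : Matrix I k K) (B : Matrix k J K) :
    span K (range (A * B).col) = (span K (range B.col)).map A.mulVecLin := by
  rw [Submodule.map_span, ← range_comp]
  rfl

theorem existsUnique_mul_eq [Fintype k] {A : Matrix I k K} {B : Matrix I J K}
    (hA : Function.Injective A.mulVecLin) (hB : ∀ j, B.col j ∈ LinearMap.range A.mulVecLin) :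
    ∃! X : Matrix k J K, A * X = B := by
  choose x hx using hB
  refine ⟨Matrix.of fun i j => x j i, Matrix.ext_col hx, fun Y hY => Matrix.ext_col fun j => hA ?_⟩
  exact (congrArg (Matrix.col · j) hY).trans (hx j).symm

theorem span_col_of_coe_basis {W : Submodule K (I → K)} {r : ℕ} (b : Module.Basis (Fin r) K W) :
    span K (range (Matrix.of fun i k => (b k : I → K) i).col) = W := by
  have h : range (Matrix.of fun i k => (b k : I → K) i).col = W.subtype '' range b := by
    rw [← range_comp]; rfl
  rw [h, ← Submodule.map_span, b.span_eq, Submodule.map_top, Submodule.range_subtype]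

theorem eRank_right_eq_of_eRank_mul_eq {r : ℕ} {A : Matrix I (Fin r) K} {B : Matrix (Fin r) J K}
    (h : (A * B).eRank = r) : B.eRank = r := by
  have hle := (span K (range B.col)).finrank_map_le A.mulVecLin
  rw [← span_col_mul, finrank_span_col_of_eRank_eq h] at hle
  have hge := (span K (range B.col)).finrank_le
  rw [Module.finrank_fin_fun] at hge
  rw [eRank_eq_finrank, hge.antisymm hle]

theorem exists_fullRank_factorization {A : Matrix I J K} {r : ℕ} (hA : A.eRank = r) :
    ∃ (O : Matrix I (Fin r) K) (R : Matrix (Fin r) J K),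
      A = O * R ∧ R.eRank = r ∧ O.eRank = r := by
  have := finiteDimensional_span_col_of_eRank_eq hA
  have hr := finrank_span_col_of_eRank_eq hA
  let b := Module.finBasisOfFinrankEq K _ hr
  have hO := span_col_of_coe_basis b
  set O := Matrix.of fun i k => (b k : I → K) i
  have hmem : ∀ j, A.col j ∈ LinearMap.range O.mulVecLin := fun j => by
    rw [Matrix.range_mulVecLin, hO]
    exact Submodule.subset_span (mem_range_self j)
  choose x hx using hmem
  have hOR : A = O * Matrix.of fun k j => x j k := Matrix.ext_col fun j => (hx j).symm
  refine ⟨O, _, hOR, eRank_right_eq_of_eRank_mul_eq (hOR ▸ hA), ?_⟩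
  rw [Matrix.eRank, Matrix.cRank, hO]
  exact hA

end Rank

/-! ### Saturation of reachable subspaces -/

section Saturation

open Module (finrank)

variable {K Q J V : Type*} [Field K] [AddCommGroup V] [Module K V]

/-- The span of the vectors `T_{q_k} ⋯ T_{q_1} b_j` over all words `q₁⋯q_k` of length `k < l`.
The strict inequality makes the chain of these subspaces start with `⊥`. -/
def reachSpan (T : Q → V →ₗ[K] V) (b : J → V) (l : ℕ) : Submodule K V :=
  Submodule.span K
    {x | ∃ (w : List Q) (j : J), w.length < l ∧ w.foldl (fun x q => T q x) (b j) = x}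

theorem foldl_mem_reachSpan (T : Q → V →ₗ[K] V) (b : J → V) {w : List Q} {l : ℕ}
    (hw : w.length < l) (j : J) : w.foldl (fun x q => T q x) (b j) ∈ reachSpan T b l :=
  Submodule.subset_span ⟨w, j, hw, rfl⟩

theorem reachSpan_mono (T : Q → V →ₗ[K] V) (b : J → V) : Monotone (reachSpan T b) := by
  refine fun k l hkl => Submodule.span_le.2 ?_
  rintro x ⟨w, j, hw, rfl⟩
  exact foldl_mem_reachSpan T b (hw.trans_le hkl) j

theorem apply_mem_reachSpan_succ (T : Q → V →ₗ[K] V) (b : J → V) (q : Q) {l : ℕ} {x : V}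
    (hx : x ∈ reachSpan T b l) : T q x ∈ reachSpan T b (l + 1) := by
  refine (Submodule.span_le (p := (reachSpan T b (l + 1)).comap (T q))).2 ?_ hx
  rintro x ⟨w, j, hw, rfl⟩
  simpa using foldl_mem_reachSpan T b (w := w ++ [q]) (by simpa using hw) j

theorem foldl_mem_reachSpan_of_succ_eq (T : Q → V →ₗ[K] V) (b : J → V) {l : ℕ}
    (h : reachSpan T b (l + 1) = reachSpan T b l) (w : List Q) (j : J) :
    w.foldl (fun x q => T q x) (b j) ∈ reachSpan T b l := by
  rw [← h]
  induction w using List.reverseRecOn with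
  | nil => exact foldl_mem_reachSpan T b (w := []) l.succ_pos j
  | append_singleton w q ih => simpa using apply_mem_reachSpan_succ T b q (h ▸ ih)

theorem exists_succ_eq_of_monotone [FiniteDimensional K V] {X : ℕ → Submodule K V}
    (hX : Monotone X) : ∃ l ≤ finrank K V, X (l + 1) = X l := by
  by_contra! hne
  have hle : ∀ l ≤ finrank K V + 1, l ≤ finrank K (X l) := by
    intro l hl
    induction l with
    | zero => exact Nat.zero_le _
    | succ l ih =>
      have hlt : X l < X (l + 1) := (hX l.le_succ).lt_of_ne (hne l (by omega)).symm
      exact (ih (by omega)).trans_lt (Submodule.finrank_lt_finrank_of_lt hlt)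
  have h := (hle _ le_rfl).trans (X _).finrank_le
  omega

theorem foldl_mem_reachSpan_of_finrank_le [FiniteDimensional K V] (T : Q → V →ₗ[K] V)
    (b : J → V) {l : ℕ} (hl : finrank K V ≤ l) (w : List Q) (j : J) :
    w.foldl (fun x q => T q x) (b j) ∈ reachSpan T b l := by
  obtain ⟨k, hk, h⟩ := exists_succ_eq_of_monotone (reachSpan_mono T b)
  exact reachSpan_mono T b (hk.trans hl) (foldl_mem_reachSpan_of_succ_eq T b h w j)

end Saturation

/-! ### Hankel matrices and partial realizations -/

section Hankel

variable {Q : Type*} {m p : ℕ} {Φ : Set (IOMap Q m p)} {n : ℕ}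

/-- The Markov parameters `S_{f,q}(w)` and `S_{q,q₀,z}(w)`, indexed uniformly by the elements
`j = f` and `j = (q₀, z)` of `J_Φ`. -/
noncomputable def markov (Φ : Set (IOMap Q m p)) (j : ColIdx Φ) (q : Q) (w : List Q) : Fin p → ℝ :=
  match j with
  | Sum.inl f => markovInit f.1 q w
  | Sum.inr j => markovInput Φ q j.1 j.2 w

theorem hankel_apply (v w : List Q) (q : Q) (i : Fin p) (j : ColIdx Φ) :
    hankel Φ (v, (q, i)) (w, j) = markov Φ j q (w ++ v) i := by
  cases j <;> rfl

theorem hankelSub_apply {L M : ℕ} (v : Words Q L) (w : Words Q M) (q : Q) (i : Fin p)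
    (j : ColIdx Φ) : hankelSub Φ L M (v, (q, i)) (w, j) = markov Φ j q (w.1 ++ v.1) i :=
  hankel_apply _ _ _ _ _

theorem eRank_hankelSub_mono {L M L' M' : ℕ} (hL : L ≤ L') (hM : M ≤ M') :
    (hankelSub Φ L M).eRank ≤ (hankelSub Φ L' M').eRank :=
  (hankelSub Φ L' M').eRank_submatrix_le
    (Prod.map (fun v : Words Q L => ⟨v.1, v.2.trans hL⟩) id)
    (Prod.map (fun w : Words Q M => ⟨w.1, w.2.trans hM⟩) id)

theorem eRank_hankelSub_le_eRank_hankel (L M : ℕ) : (hankelSub Φ L M).eRank ≤ (hankel Φ).eRank :=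
  (hankel Φ).eRank_submatrix_le _ _

theorem rankCondition_of_eRank_eq {N : ℕ} (h : (hankelSub Φ N N).eRank = (hankel Φ).eRank) :
    RankCondition Φ N := by
  have h₁ : (hankelSub Φ (N + 1) N).eRank = (hankelSub Φ N N).eRank :=
    le_antisymm ((eRank_hankelSub_le_eRank_hankel _ _).trans h.ge)
      (eRank_hankelSub_mono N.le_succ le_rfl)
  have h₂ : (hankelSub Φ N (N + 1)).eRank = (hankelSub Φ N N).eRank :=
    le_antisymm ((eRank_hankelSub_le_eRank_hankel _ _).trans h.ge)
      (eRank_hankelSub_mono le_rfl N.le_succ)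
  exact ⟨h₁.symm, h₁.trans h₂.symm⟩

/-- The restriction of a column of the Hankel matrix to the rows of `H_{Φ,L,M}`. -/
def restrictRows (Q : Type*) (p L : ℕ) :
    (List Q × (Q × Fin p) → ℝ) →ₗ[ℝ] (Words Q L × (Q × Fin p) → ℝ) :=
  LinearMap.funLeft ℝ ℝ (Prod.map Subtype.val id)

/-- The shift of the rows of the Hankel matrix which replaces the row word `v` by `qv`. -/
def shiftRows (p : ℕ) (q : Q) :
    (List Q × (Q × Fin p) → ℝ) →ₗ[ℝ] (List Q × (Q × Fin p) → ℝ) :=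
  LinearMap.funLeft ℝ ℝ (Prod.map (List.cons q) id)

theorem shiftRows_hankel_col (q : Q) (w : List Q) (j : ColIdx Φ) :
    shiftRows p q ((hankel Φ).col (w, j)) = (hankel Φ).col (w ++ [q], j) := by
  ext ⟨v, q', i⟩
  rw [Matrix.col_apply, hankel_apply, List.append_assoc]
  exact hankel_apply _ _ _ _ _

theorem span_hankelSub_col_le_map (L M : ℕ) : Submodule.span ℝ (range (hankelSub Φ L M).col) ≤
    (Submodule.span ℝ (range (hankel Φ).col)).map (restrictRows Q p L) := by
  rw [Submodule.map_span]
  refine Submodule.span_mono ?_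
  rintro _ ⟨⟨w, j⟩, rfl⟩
  exact mem_image_of_mem _ (mem_range_self (w.1, j))

namespace LSS

theorem prodA_append (sys : LSS Q n m p) (w v : List Q) :
    sys.prodA (w ++ v) = sys.prodA v * sys.prodA w := by
  induction w with
  | nil => simp [prodA]
  | cons q w ih => simp [prodA, ih, Matrix.mul_assoc]

theorem foldl_mulVec (sys : LSS Q n m p) (w : List Q) (x : Fin n → ℝ) :
    w.foldl (fun x q => (sys.A q).mulVecLin x) x = sys.prodA w *ᵥ x := by
  induction w generalizing x with
  | nil => simp [prodA]
  | cons q w ih => rw [List.foldl_cons, ih, Matrix.mulVecLin_apply, Matrix.mulVec_mulVec, prodA]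

theorem foldl_reverse_vecMul (sys : LSS Q n m p) (w : List Q) (x : Fin n → ℝ) :
    w.reverse.foldl (fun x q => (sys.A q).vecMulLinear x) x = x ᵥ* sys.prodA w := by
  induction w generalizing x with
  | nil => simp [prodA]
  | cons q w ih => simp [prodA, ← Matrix.vecMul_vecMul, ← ih]

/-- The observability map: it sends a state `x` to the column with entries
`C_q A_{q_k} ⋯ A_{q_1} x`. -/
def obs (sys : LSS Q n m p) : (Fin n → ℝ) →ₗ[ℝ] (List Q × (Q × Fin p) → ℝ) where
  toFun x v := (sys.C v.2.1 *ᵥ (sys.prodA v.1 *ᵥ x)) v.2.2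
  map_add' x y := by ext v; simp [Matrix.mulVec_add]
  map_smul' c x := by ext v; simp [Matrix.mulVec_smul]

/-- The observability map for words of length at most `L`. -/
def truncObs (sys : LSS Q n m p) (L : ℕ) : (Fin n → ℝ) →ₗ[ℝ] (Words Q L × (Q × Fin p) → ℝ) :=
  restrictRows Q p L ∘ₗ sys.obs

theorem obs_apply_eq_dotProduct (sys : LSS Q n m p) (x : Fin n → ℝ) (v : List Q) (q : Q)
    (i : Fin p) : sys.obs x (v, (q, i)) = ((sys.C q).row i ᵥ* sys.prodA v) ⬝ᵥ x :=
  Matrix.dotProduct_mulVec ((sys.C q).row i) (sys.prodA v) x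

theorem obs_eq_zero_of_truncObs_eq_zero (sys : LSS Q n m p) {N : ℕ} (hn : n ≤ N + 1)
    {x : Fin n → ℝ} (hx : sys.truncObs N x = 0) : sys.obs x = 0 := by
  let c : Q × Fin p → (Fin n → ℝ) := fun i => (sys.C i.1).row i.2
  have hspan : reachSpan (fun q => (sys.A q).vecMulLinear) c (N + 1) ≤
      LinearMap.ker ((dotProductBilin ℝ ℝ).flip x : (Fin n → ℝ) →ₗ[ℝ] ℝ) := by
    refine Submodule.span_le.2 ?_
    rintro y ⟨w, ⟨q, i⟩, hw, rfl⟩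
    have h : sys.obs x (w.reverse, (q, i)) = 0 :=
      congrFun hx (⟨w.reverse, by simpa using Nat.le_of_lt_succ hw⟩, (q, i))
    rwa [obs_apply_eq_dotProduct, ← foldl_reverse_vecMul, List.reverse_reverse] at h
  ext ⟨v, q, i⟩
  rw [obs_apply_eq_dotProduct, ← foldl_reverse_vecMul]
  exact hspan (foldl_mem_reachSpan_of_finrank_le _ c (by simpa using hn) v.reverse (q, i))

end LSS

namespace Realization

/-- The vectors `μ(f)` and `B_{q₀} e_z`, indexed by the elements `f` and `(q₀, z)` of `J_Φ`. -/
def inVec (Z : Realization Φ n) (j : ColIdx Φ) : Fin n → ℝ :=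
  match j with
  | Sum.inl f => Z.μ f
  | Sum.inr j => (Z.sys.B j.1).col j.2

/-- The vectors `A_{q_k} ⋯ A_{q_1} μ(f)` and `A_{q_k} ⋯ A_{q_1} B_{q₀} e_z`, the counterparts of
the columns of the Hankel matrix in the state space. -/
def reachVec (Z : Realization Φ n) (w : List Q) (j : ColIdx Φ) : Fin n → ℝ :=
  Z.sys.prodA w *ᵥ Z.inVec j

theorem reachVec_nil (Z : Realization Φ n) (j : ColIdx Φ) : Z.reachVec [] j = Z.inVec j :=
  Matrix.one_mulVec _

theorem reachVec_append (Z : Realization Φ n) (w v : List Q) (j : ColIdx Φ) :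
    Z.reachVec (w ++ v) j = Z.sys.prodA v *ᵥ Z.reachVec w j := by
  rw [reachVec, Z.sys.prodA_append, ← Matrix.mulVec_mulVec, reachVec]

theorem reachVec_append_singleton (Z : Realization Φ n) (w : List Q) (q : Q) (j : ColIdx Φ) :
    Z.reachVec (w ++ [q]) j = Z.sys.A q *ᵥ Z.reachVec w j := by
  rw [reachVec_append, LSS.prodA, LSS.prodA, Matrix.one_mul]

theorem isPartialRealization_iff {Z : Realization Φ n} {M : ℕ} :
    Z.IsPartialRealization M ↔ ∀ (q : Q) (w : List Q), w.length ≤ M → ∀ j : ColIdx Φ,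
      markov Φ j q w = Z.sys.C q *ᵥ Z.reachVec w j := by
  refine forall₂_congr fun q w => imp_congr_right fun _ => ?_
  rw [Sum.forall, and_comm, Prod.forall]
  refine and_congr (forall_congr' fun f => ?_) (forall₂_congr fun q₀ j => ?_)
  · rw [← Matrix.mulVec_mulVec]; rfl
  · rw [← Matrix.mulVec_mulVec, ← Matrix.mulVec_mulVec, Matrix.mulVec_single_one]; rfl

theorem IsPartialRealization.mono {Z : Realization Φ n} {L M : ℕ} (h : Z.IsPartialRealization M)
    (hLM : L ≤ M) : Z.IsPartialRealization L :=
  fun q w hw => h q w (hw.trans hLM)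

theorem IsPartialRealization.obs_reachVec_apply {Z : Realization Φ n} {M : ℕ}
    (h : Z.IsPartialRealization M) {w v : List Q} (hwv : (w ++ v).length ≤ M) (j : ColIdx Φ)
    (q : Q) (i : Fin p) : Z.sys.obs (Z.reachVec w j) (v, (q, i)) = markov Φ j q (w ++ v) i := by
  rw [isPartialRealization_iff.1 h q _ hwv, reachVec_append]
  rfl

theorem obs_reachVec {Z : Realization Φ n} (h : ∀ M, Z.IsPartialRealization M) (w : List Q)
    (j : ColIdx Φ) : Z.sys.obs (Z.reachVec w j) = (hankel Φ).col (w, j) := by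
  ext ⟨v, q, i⟩
  rw [Matrix.col_apply, hankel_apply, (h _).obs_reachVec_apply le_rfl]

theorem IsPartialRealization.truncObs_reachVec {Z : Realization Φ n} {L M : ℕ}
    (h : Z.IsPartialRealization (M + L)) (w : Words Q M) (j : ColIdx Φ) :
    Z.sys.truncObs L (Z.reachVec w.1 j) = (hankelSub Φ L M).col (w, j) := by
  ext ⟨v, q, i⟩
  rw [Matrix.col_apply, hankelSub_apply]
  exact h.obs_reachVec_apply (by simpa using add_le_add w.2 v.2) j q i

theorem IsPartialRealization.eRank_hankelSub_le {Z : Realization Φ n} {L M : ℕ}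
    (h : Z.IsPartialRealization (M + L)) : (hankelSub Φ L M).eRank ≤ n := by
  rw [← Module.finrank_fin_fun (n := n) ℝ]
  exact eRank_le_finrank_of_col_mem_range (Z.sys.truncObs L) fun c =>
    ⟨_, h.truncObs_reachVec c.1 c.2⟩

theorem eRank_hankel_le {Z : Realization Φ n} (h : ∀ M, Z.IsPartialRealization M) :
    (hankel Φ).eRank ≤ n := by
  rw [← Module.finrank_fin_fun (n := n) ℝ]
  exact eRank_le_finrank_of_col_mem_range Z.sys.obs fun c => ⟨_, obs_reachVec h c.1 c.2⟩

theorem span_hankel_col_le_map_obs {Z : Realization Φ n} (h : ∀ M, Z.IsPartialRealization M)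
    {N : ℕ} (hn : n ≤ N + 1) : Submodule.span ℝ (range (hankel Φ).col) ≤
      (reachSpan (fun q => (Z.sys.A q).mulVecLin) Z.inVec (N + 1)).map Z.sys.obs := by
  refine Submodule.span_le.2 ?_
  rintro _ ⟨⟨w, j⟩, rfl⟩
  refine ⟨_, foldl_mem_reachSpan_of_finrank_le _ _ (by simpa using hn) w j, ?_⟩
  rw [LSS.foldl_mulVec]
  exact obs_reachVec h w j

theorem IsPartialRealization.map_truncObs_reachSpan_le {Z : Realization Φ n} {L M : ℕ}
    (h : Z.IsPartialRealization (M + L)) :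
    (reachSpan (fun q => (Z.sys.A q).mulVecLin) Z.inVec (M + 1)).map (Z.sys.truncObs L) ≤
      Submodule.span ℝ (range (hankelSub Φ L M).col) := by
  rw [reachSpan, Submodule.map_span]
  refine Submodule.span_mono ?_
  rintro _ ⟨_, ⟨w, j, hw, rfl⟩, rfl⟩
  rw [LSS.foldl_mulVec]
  exact ⟨(⟨w, Nat.le_of_lt_succ hw⟩, j), (h.truncObs_reachVec _ j).symm⟩

theorem eRank_hankelSub_eq_eRank_hankel {Z : Realization Φ n}
    (h : ∀ M, Z.IsPartialRealization M) {N : ℕ} (hn : n ≤ N + 1) :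
    (hankelSub Φ N N).eRank = (hankel Φ).eRank := by
  have hobs := span_hankel_col_le_map_obs h hn
  refine eRank_eq_of_span_col_eq_map (f := restrictRows Q p N) ?_
    ((span_hankelSub_col_le_map N N).antisymm ?_)
  · refine (injOn_iff_map_eq_zero _ _).2 fun y hy hy0 => ?_
    obtain ⟨x, -, rfl⟩ := hobs hy
    exact Z.sys.obs_eq_zero_of_truncObs_eq_zero hn hy0
  · refine (Submodule.map_mono hobs).trans ?_
    rw [← Submodule.map_comp]
    exact (h (N + N)).map_truncObs_reachSpan_le

end Realization

end Hankel

/-! ### Partial realizations whose dimension is the rank of the Hankel matrix -/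

section PartialRealization

variable {Q : Type*} {m p : ℕ} {Φ : Set (IOMap Q m p)} {N n : ℕ}

theorem column_coe_apply (w : Words Q (N + 1)) (j : ColIdx Φ) (v : Words Q N) (q : Q)
    (i : Fin p) : (column Φ N w j : Words Q N × (Q × Fin p) → ℝ) (v, (q, i)) =
      markov Φ j q (w.1 ++ v.1) i :=
  hankelSub_apply v w q i j

theorem span_hankelSub_col_eq_colSpace (hrank : RankCondition Φ N)
    (hn : (hankelSub Φ N N).eRank = n) :
    Submodule.span ℝ (range (hankelSub Φ N N).col) = colSpace Φ N := by
  have hn' : (hankelSub Φ N (N + 1)).eRank = n := hrank.2.symm.trans (hrank.1.symm.trans hn)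
  have : FiniteDimensional ℝ (colSpace Φ N) := finiteDimensional_span_col_of_eRank_eq hn'
  refine Submodule.eq_of_le_of_finrank_eq (Submodule.span_mono ?_)
    ((finrank_span_col_of_eRank_eq hn).trans (finrank_span_col_of_eRank_eq hn').symm)
  rintro _ ⟨⟨w, j⟩, rfl⟩
  exact ⟨(⟨w.1, w.2.trans N.le_succ⟩, j), rfl⟩

theorem span_column_eq_top (hrank : RankCondition Φ N) (hn : (hankelSub Φ N N).eRank = n) :
    Submodule.span ℝ (range fun c : Words Q N × ColIdx Φ =>
      column Φ N ⟨c.1.1, c.1.2.trans N.le_succ⟩ c.2) = ⊤ := by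
  apply Submodule.map_injective_of_injective (colSpace Φ N).injective_subtype
  rw [Submodule.map_span, ← range_comp, Submodule.map_top, Submodule.range_subtype]
  exact span_hankelSub_col_eq_colSpace hrank hn

namespace Realization

variable {Z : Realization Φ n}

theorem IsPartialRealization.span_hankelSub_col {L M : ℕ} (h : Z.IsPartialRealization (M + L)) :
    Submodule.span ℝ (range (hankelSub Φ L M).col) =
      (Submodule.span ℝ (range fun c : Words Q M × ColIdx Φ => Z.reachVec c.1.1 c.2)).map
        (Z.sys.truncObs L) := by
  rw [Submodule.map_span, ← range_comp]
  exact congrArg (fun c => Submodule.span ℝ (range c))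
    (funext fun c => (h.truncObs_reachVec c.1 c.2).symm)

theorem IsPartialRealization.span_reachVec_eq_top {L M : ℕ} (h : Z.IsPartialRealization (M + L))
    (hn : (hankelSub Φ L M).eRank = n) :
    Submodule.span ℝ (range fun c : Words Q M × ColIdx Φ => Z.reachVec c.1.1 c.2) = ⊤ := by
  refine Submodule.eq_top_of_finrank_eq ((Submodule.finrank_le _).antisymm ?_)
  have hle := (Submodule.span ℝ (range fun c : Words Q M × ColIdx Φ =>
    Z.reachVec c.1.1 c.2)).finrank_map_le (Z.sys.truncObs L)
  rw [← h.span_hankelSub_col, finrank_span_col_of_eRank_eq hn] at hle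
  exact (Module.finrank_fin_fun ℝ).trans_le hle

theorem IsPartialRealization.injective_truncObs {L M : ℕ} (h : Z.IsPartialRealization (M + L))
    (hn : (hankelSub Φ L M).eRank = n) : Function.Injective (Z.sys.truncObs L) := by
  have hinj : InjOn (Z.sys.truncObs L) (⊤ : Submodule ℝ (Fin n → ℝ)) := by
    apply injOn_of_finrank_le_finrank_map
    rw [← h.span_reachVec_eq_top hn, ← h.span_hankelSub_col, h.span_reachVec_eq_top hn,
      finrank_span_col_of_eRank_eq hn, finrank_top, Module.finrank_fin_fun]
  exact injOn_univ.1 hinj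

theorem IsPartialRealization.range_truncObs {L M : ℕ} (h : Z.IsPartialRealization (M + L))
    (hn : (hankelSub Φ L M).eRank = n) : LinearMap.range (Z.sys.truncObs L) =
      Submodule.span ℝ (range (hankelSub Φ L M).col) := by
  rw [h.span_hankelSub_col, h.span_reachVec_eq_top hn, Submodule.map_top]

theorem IsPartialRealization.exists_equiv_colSpace (h : Z.IsPartialRealization (2 * N + 1))
    (hrank : RankCondition Φ N) (hn : (hankelSub Φ N N).eRank = n) :
    ∃ E : (Fin n → ℝ) ≃ₗ[ℝ] colSpace Φ N,
      ∀ (w : Words Q (N + 1)) (j : ColIdx Φ), E (Z.reachVec w.1 j) = column Φ N w j := by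
  have hNN : Z.IsPartialRealization (N + N) := h.mono (by omega)
  refine ⟨(LinearEquiv.ofInjective _ (hNN.injective_truncObs hn)).trans (LinearEquiv.ofEq _ _
    ((hNN.range_truncObs hn).trans (span_hankelSub_col_eq_colSpace hrank hn))), fun w j => ?_⟩
  exact Subtype.ext ((h.mono (by omega : N + 1 + N ≤ 2 * N + 1)).truncObs_reachVec w j)

theorem IsPartialRealization.isMinimalPartialRealization {M : ℕ} (h : Z.IsPartialRealization M)
    (hM : N + N ≤ M) (hn : (hankelSub Φ N N).eRank = n) : Z.IsMinimalPartialRealization M := by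
  refine ⟨h, fun k Z' hZ' => ?_⟩
  have hle := (hZ'.mono hM).eRank_hankelSub_le
  rw [hn] at hle
  exact_mod_cast hle

end Realization

/-! ### The column-space algorithm -/

namespace Realization

variable {n' : ℕ}

/-- The realization obtained from `Z` by the change of state coordinates `T`. -/
def map (Z : Realization Φ n) (T : (Fin n → ℝ) ≃ₗ[ℝ] (Fin n' → ℝ)) : Realization Φ n' where
  sys :=
    { A := fun q => LinearMap.toMatrix' (T.conj (Z.sys.A q).mulVecLin)
      B := fun q => LinearMap.toMatrix' (T.toLinearMap ∘ₗ (Z.sys.B q).mulVecLin)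
      C := fun q => LinearMap.toMatrix' ((Z.sys.C q).mulVecLin ∘ₗ T.symm.toLinearMap) }
  μ := fun f => T (Z.μ f)

variable (Z : Realization Φ n) (T : (Fin n → ℝ) ≃ₗ[ℝ] (Fin n' → ℝ))

theorem map_A_mulVec (q : Q) (x : Fin n → ℝ) :
    (Z.map T).sys.A q *ᵥ T x = T (Z.sys.A q *ᵥ x) := by
  simp [map, LinearEquiv.conj_apply]

theorem map_B_mulVec (q : Q) (e : Fin m → ℝ) :
    (Z.map T).sys.B q *ᵥ e = T (Z.sys.B q *ᵥ e) := by
  simp [map]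

theorem map_C_mulVec (q : Q) (x : Fin n → ℝ) :
    (Z.map T).sys.C q *ᵥ T x = Z.sys.C q *ᵥ x := by
  simp [map]

theorem map_inVec (j : ColIdx Φ) : (Z.map T).inVec j = T (Z.inVec j) := by
  obtain f | ⟨q, j⟩ := j
  · rfl
  · simpa [inVec] using Z.map_B_mulVec T q (Pi.single j 1)

theorem isomorphic_map : Z.Isomorphic (Z.map T) :=
  ⟨T, Z.map_A_mulVec T, Z.map_B_mulVec T, Z.map_C_mulVec T, fun _ => rfl⟩

variable {Z}

theorem IsPartialRealization.isColumnSpaceOutput_map (h : Z.IsPartialRealization (2 * N + 1))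
    {E : (Fin n → ℝ) ≃ₗ[ℝ] colSpace Φ N}
    (hE : ∀ (w : Words Q (N + 1)) (j : ColIdx Φ), E (Z.reachVec w.1 j) = column Φ N w j)
    (S : colSpace Φ N ≃ₗ[ℝ] (Fin n' → ℝ)) : IsColumnSpaceOutput Φ N S (Z.map (E.trans S)) := by
  have hT : ∀ (w : Words Q (N + 1)) (j : ColIdx Φ),
      S (column Φ N w j) = (E.trans S) (Z.reachVec w.1 j) := fun w j => by
    rw [LinearEquiv.trans_apply, hE]
  have hin : ∀ j : ColIdx Φ, (Z.map (E.trans S)).inVec j = S (column Φ N ⟨[], by simp⟩ j) :=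
    fun j => by rw [map_inVec, hT, reachVec_nil]
  refine ⟨fun q j => hin (Sum.inr (q, j)), fun q w j => ?_, fun q w j => ?_,
    fun f => hin (Sum.inl f)⟩
  · ext i
    rw [hT, map_C_mulVec, hankelSub_apply, List.append_nil,
      isPartialRealization_iff.1 h q w.1 (by have := w.2; omega)]
  · rw [LinearEquiv.symm_apply_eq, hT, hT, map_A_mulVec, reachVec_append_singleton]

end Realization

theorem IsColumnSpaceOutput.unique (hrank : RankCondition Φ N)
    (hn : (hankelSub Φ N N).eRank = n) {n' : ℕ} {S : colSpace Φ N ≃ₗ[ℝ] (Fin n' → ℝ)}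
    {Z Z' : Realization Φ n'} (hZ : IsColumnSpaceOutput Φ N S Z)
    (hZ' : IsColumnSpaceOutput Φ N S Z') : Z = Z' := by
  obtain ⟨⟨A, B, C⟩, μ⟩ := Z
  obtain ⟨⟨A', B', C'⟩, μ'⟩ := Z'
  obtain ⟨hB, hC, hA, hμ⟩ := hZ
  obtain ⟨hB', hC', hA', hμ'⟩ := hZ'
  have hext : ∀ {k : ℕ} {F F' : Matrix (Fin k) (Fin n') ℝ},
      (∀ (w : Words Q N) (j : ColIdx Φ), F *ᵥ S (column Φ N ⟨w.1, w.2.trans N.le_succ⟩ j) =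
        F' *ᵥ S (column Φ N ⟨w.1, w.2.trans N.le_succ⟩ j)) → F = F' := fun {k F F'} h => by
    have hcomp : F.mulVecLin ∘ₗ S.toLinearMap = F'.mulVecLin ∘ₗ S.toLinearMap :=
      LinearMap.ext_on_range (span_column_eq_top hrank hn) fun c => h c.1 c.2
    refine Matrix.mulVec_injective (funext fun x => ?_)
    simpa using LinearMap.congr_fun hcomp (S.symm x)
  have hAA' : A = A' := funext fun q => hext fun w j =>
    S.symm.injective ((hA q w j).trans (hA' q w j).symm)
  have hBB' : B = B' := funext fun q => Matrix.ext_col fun j => (hB q j).trans (hB' q j).symm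
  have hCC' : C = C' := funext fun q => hext fun w j => (hC q _ j).trans (hC' q _ j).symm
  have hμμ' : μ = μ' := funext fun f => (hμ f).trans (hμ' f).symm
  rw [hAA', hBB', hCC', hμμ']

theorem Realization.IsPartialRealization.exists_isColumnSpaceOutput {Z : Realization Φ n}
    (h : Z.IsPartialRealization (2 * N + 1)) (hrank : RankCondition Φ N)
    (hn : (hankelSub Φ N N).eRank = n) {n' : ℕ} (S : colSpace Φ N ≃ₗ[ℝ] (Fin n' → ℝ)) :
    ∃ Z' : Realization Φ n', IsColumnSpaceOutput Φ N S Z' ∧ Z.Isomorphic Z' := by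
  obtain ⟨E, hE⟩ := h.exists_equiv_colSpace hrank hn
  exact ⟨_, h.isColumnSpaceOutput_map hE S, Z.isomorphic_map _⟩

theorem Realization.IsPartialRealization.isomorphic_of_isColumnSpaceOutput {Z : Realization Φ n}
    (h : Z.IsPartialRealization (2 * N + 1)) (hrank : RankCondition Φ N)
    (hn : (hankelSub Φ N N).eRank = n) {n' : ℕ} {S : colSpace Φ N ≃ₗ[ℝ] (Fin n' → ℝ)}
    {Z' : Realization Φ n'} (hZ' : IsColumnSpaceOutput Φ N S Z') : Z.Isomorphic Z' := by
  obtain ⟨Z'', hZ'', hiso⟩ := h.exists_isColumnSpaceOutput hrank hn S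
  rwa [hZ'.unique hrank hn hZ'']

/-! ### Extension of partial realizations when the rank is that of the full Hankel matrix -/

theorem exists_linearMap_hankelSub_col_eq (hn : (hankelSub Φ N N).eRank = n)
    (hH : (hankel Φ).eRank = n) :
    ∃ g : (Words Q N × (Q × Fin p) → ℝ) →ₗ[ℝ] (List Q × (Q × Fin p) → ℝ),
      ∀ {M : ℕ} (w : Words Q M) (j : ColIdx Φ),
        g ((hankelSub Φ N M).col (w, j)) = (hankel Φ).col (w.1, j) := by
  set W := Submodule.span ℝ (range (hankel Φ).col)
  have : FiniteDimensional ℝ W := finiteDimensional_span_col_of_eRank_eq hH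
  have hinj : InjOn (restrictRows Q p N) W := by
    refine injOn_of_finrank_le_finrank_map ?_
    rw [finrank_span_col_of_eRank_eq hH, ← finrank_span_col_of_eRank_eq hn]
    exact Submodule.finrank_mono (span_hankelSub_col_le_map N N)
  obtain ⟨g, hg⟩ := ((restrictRows Q p N).domRestrict W).exists_leftInverse_of_injective
    (LinearMap.ker_eq_bot.2 (injOn_iff_injective.1 hinj))
  exact ⟨W.subtype ∘ₗ g, fun w j => congrArg Subtype.val
    (LinearMap.congr_fun hg ⟨_, Submodule.subset_span (mem_range_self (w.1, j))⟩)⟩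

namespace Realization

variable {Z : Realization Φ n}

theorem IsPartialRealization.exists_linearMap_reachVec_eq_hankel_col
    (h : Z.IsPartialRealization (2 * N + 1)) (hn : (hankelSub Φ N N).eRank = n)
    (hH : (hankel Φ).eRank = n) :
    ∃ F : (Fin n → ℝ) →ₗ[ℝ] (List Q × (Q × Fin p) → ℝ), ∀ (w : List Q) (j : ColIdx Φ),
      w.length ≤ N + 1 → F (Z.reachVec w j) = (hankel Φ).col (w, j) := by
  obtain ⟨g, hg⟩ := exists_linearMap_hankelSub_col_eq hn hH
  refine ⟨g ∘ₗ Z.sys.truncObs N, fun w j hw => ?_⟩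
  rw [← hg ⟨w, hw⟩ j, ← (h.mono (by omega : N + 1 + N ≤ 2 * N + 1)).truncObs_reachVec ⟨w, hw⟩ j,
    LinearMap.comp_apply]

theorem apply_reachVec_eq_hankel_col
    (hspan : Submodule.span ℝ
      (range fun c : Words Q N × ColIdx Φ => Z.reachVec c.1.1 c.2) = ⊤)
    {F : (Fin n → ℝ) →ₗ[ℝ] (List Q × (Q × Fin p) → ℝ)}
    (hF : ∀ (w : List Q) (j : ColIdx Φ), w.length ≤ N + 1 →
      F (Z.reachVec w j) = (hankel Φ).col (w, j)) (w : List Q) (j : ColIdx Φ) :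
    F (Z.reachVec w j) = (hankel Φ).col (w, j) := by
  have hshift : ∀ q, shiftRows p q ∘ₗ F = F ∘ₗ (Z.sys.A q).mulVecLin := fun q =>
    LinearMap.ext_on_range hspan fun ⟨⟨w, hw⟩, j⟩ => by
      rw [LinearMap.comp_apply, LinearMap.comp_apply, Matrix.mulVecLin_apply,
        ← reachVec_append_singleton, hF w j (hw.trans N.le_succ), hF _ j (by simpa using hw),
        shiftRows_hankel_col]
  induction w using List.reverseRecOn with
  | nil => exact hF [] j (Nat.zero_le _)
  | append_singleton w q ih =>
    rw [reachVec_append_singleton, ← shiftRows_hankel_col, ← ih]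
    exact (LinearMap.congr_fun (hshift q) _).symm

theorem IsPartialRealization.of_eRank_eq (h : Z.IsPartialRealization (2 * N + 1))
    (hn : (hankelSub Φ N N).eRank = n) (hH : (hankel Φ).eRank = n) (M : ℕ) :
    Z.IsPartialRealization M := by
  obtain ⟨F, hF⟩ := h.exists_linearMap_reachVec_eq_hankel_col hn hH
  have hspan := (h.mono (by omega : N + N ≤ 2 * N + 1)).span_reachVec_eq_top hn
  have houtput : ∀ q i, LinearMap.proj ([], (q, i)) ∘ₗ F =
      LinearMap.proj i ∘ₗ (Z.sys.C q).mulVecLin := fun q i =>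
    LinearMap.ext_on_range hspan fun ⟨⟨w, hw⟩, j⟩ => by
      rw [LinearMap.comp_apply, LinearMap.comp_apply, Matrix.mulVecLin_apply,
        hF w j (hw.trans N.le_succ), ← isPartialRealization_iff.1 h q w (by omega),
        LinearMap.proj_apply, LinearMap.proj_apply, Matrix.col_apply, hankel_apply,
        List.append_nil]
  refine isPartialRealization_iff.2 fun q w _ j => funext fun i => ?_
  have hwj := LinearMap.congr_fun (houtput q i) (Z.reachVec w j)
  rw [LinearMap.comp_apply, apply_reachVec_eq_hankel_col hspan hF, LinearMap.proj_apply,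
    Matrix.col_apply, hankel_apply, List.append_nil] at hwj
  exact hwj

end Realization

end PartialRealization

/-! ### The factorization algorithm -/

section Factorization

variable {Q : Type*} {m p : ℕ} {Φ : Set (IOMap Q m p)} {N r : ℕ}
  {O : Matrix (Words Q (N + 1) × (Q × Fin p)) (Fin r) ℝ}
  {R : Matrix (Fin r) (Words Q N × ColIdx Φ) ℝ}

theorem exists_isFullRankFactorization [Finite Q] (Φ : Set (IOMap Q m p)) (N : ℕ) :
    ∃ (r : ℕ) (O : Matrix (Words Q (N + 1) × (Q × Fin p)) (Fin r) ℝ)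
      (R : Matrix (Fin r) (Words Q N × ColIdx Φ) ℝ), IsFullRankFactorization O R := by
  have : Finite (Words Q (N + 1)) := (List.finite_length_le Q (N + 1)).to_subtype
  obtain ⟨r, hr⟩ := ENat.ne_top_iff_exists.1
    ((hankelSub Φ (N + 1) N).eRank_le_card_height.trans_lt ENat.card_lt_top_of_finite).ne
  obtain ⟨O, R, hOR, hR, hO⟩ := exists_fullRank_factorization hr.symm
  exact ⟨r, O, R, hOR, hR, hO, hr.symm⟩

namespace IsFullRankFactorization

theorem span_col_eq_top (hOR : IsFullRankFactorization O R) :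
    Submodule.span ℝ (range R.col) = ⊤ :=
  Submodule.eq_top_of_finrank_eq <| by
    rw [finrank_span_col_of_eRank_eq hOR.2.1, Module.finrank_fin_fun]

theorem eRank_hankelSub_eq (hOR : IsFullRankFactorization O R) (hrank : RankCondition Φ N) :
    (hankelSub Φ N N).eRank = r :=
  hrank.1.trans hOR.2.2.2

theorem mulVec_col_apply (hOR : IsFullRankFactorization O R) (v : Words Q (N + 1)) (q : Q)
    (i : Fin p) (w : Words Q N) (j : ColIdx Φ) :
    (O *ᵥ R.col (w, j)) (v, (q, i)) = markov Φ j q (w.1 ++ v.1) i := by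
  rw [← hankelSub_apply v w q i j, hOR.1]
  rfl

theorem gammaBar_mulVec (hOR : IsFullRankFactorization O R) (w : Words Q N) (j : ColIdx Φ) :
    gammaBar O *ᵥ R.col (w, j) = column Φ N ⟨w.1, w.2.trans N.le_succ⟩ j := by
  ext ⟨v, q, i⟩
  rw [column_coe_apply]
  exact hOR.mulVec_col_apply ⟨v.1, v.2.trans N.le_succ⟩ q i w j

theorem gammaShift_mulVec (hOR : IsFullRankFactorization O R) (q : Q) (w : Words Q N)
    (j : ColIdx Φ) :
    gammaShift O q *ᵥ R.col (w, j) = column Φ N ⟨w.1 ++ [q], by simpa using w.2⟩ j := by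
  ext ⟨v, q', i⟩
  rw [column_coe_apply, List.append_assoc, List.singleton_append]
  exact hOR.mulVec_col_apply ⟨q :: v.1, by simpa using v.2⟩ q' i w j

theorem range_gammaBar (hOR : IsFullRankFactorization O R) :
    LinearMap.range (gammaBar O).mulVecLin = Submodule.span ℝ (range (hankelSub Φ N N).col) := by
  have hmul : gammaBar O * R = hankelSub Φ N N :=
    Matrix.ext_col fun c => hOR.gammaBar_mulVec c.1 c.2
  rw [← hmul, span_col_mul, hOR.span_col_eq_top, Submodule.map_top]

theorem injective_gammaBar (hOR : IsFullRankFactorization O R) (hrank : RankCondition Φ N) :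
    Function.Injective (gammaBar O).mulVecLin := by
  refine injOn_univ.1 (injOn_of_finrank_le_finrank_map (Y := ⊤) ?_)
  rw [Submodule.map_top, hOR.range_gammaBar,
    finrank_span_col_of_eRank_eq (hOR.eRank_hankelSub_eq hrank), finrank_top,
    Module.finrank_fin_fun]

theorem gammaShift_mulVec_mem_range (hOR : IsFullRankFactorization O R)
    (hrank : RankCondition Φ N) (q : Q) (x : Fin r → ℝ) :
    gammaShift O q *ᵥ x ∈ LinearMap.range (gammaBar O).mulVecLin := by
  have hle : Submodule.span ℝ (range R.col) ≤
      (LinearMap.range (gammaBar O).mulVecLin).comap (gammaShift O q).mulVecLin := by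
    refine Submodule.span_le.2 (range_subset_iff.2 fun ⟨w, j⟩ => ?_)
    change gammaShift O q *ᵥ R.col (w, j) ∈ LinearMap.range (gammaBar O).mulVecLin
    rw [hOR.gammaShift_mulVec, hOR.range_gammaBar,
      span_hankelSub_col_eq_colSpace hrank (hOR.eRank_hankelSub_eq hrank)]
    exact Subtype.property _
  exact hle (hOR.span_col_eq_top ▸ Submodule.mem_top)

theorem existsUnique_gammaBar_mul_eq (hOR : IsFullRankFactorization O R)
    (hrank : RankCondition Φ N) (q : Q) :
    ∃! A : Matrix (Fin r) (Fin r) ℝ, gammaBar O * A = gammaShift O q :=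
  existsUnique_mul_eq (hOR.injective_gammaBar hrank) fun k => by
    rw [← Matrix.mulVec_single_one]
    exact hOR.gammaShift_mulVec_mem_range hrank q _

end IsFullRankFactorization

/-- The equations satisfied by an output `Z` of the factorization algorithm. -/
structure Realization.IsFactorizationOutput (Z : Realization Φ r)
    (O : Matrix (Words Q (N + 1) × (Q × Fin p)) (Fin r) ℝ)
    (R : Matrix (Fin r) (Words Q N × ColIdx Φ) ℝ) : Prop where
  gammaBar_mul_A : ∀ q, gammaBar O * Z.sys.A q = gammaShift O q
  inVec_eq : ∀ j, Z.inVec j = R.col (⟨[], by simp⟩, j)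
  C_row_eq : ∀ q i, Z.sys.C q i = O (⟨[], by simp⟩, (q, i))

theorem IsFullRankFactorization.exists_isFactorizationOutput (hOR : IsFullRankFactorization O R)
    (hrank : RankCondition Φ N) :
    ∃ Z : Realization Φ r, factorizationAlgorithm O R = some Z ∧ Z.IsFactorizationOutput O R := by
  have h := hOR.existsUnique_gammaBar_mul_eq hrank
  refine ⟨_, dif_pos h, fun q => (h q).choose_spec.1, ?_, fun _ _ => rfl⟩
  rintro (f | j) <;> rfl

namespace Realization.IsFactorizationOutput

variable {Z : Realization Φ r}

theorem reachVec_eq (hZ : Z.IsFactorizationOutput O R) (hOR : IsFullRankFactorization O R)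
    (hrank : RankCondition Φ N) (w : Words Q N) (j : ColIdx Φ) :
    Z.reachVec w.1 j = R.col (w, j) := by
  obtain ⟨w, hw⟩ := w
  induction w using List.reverseRecOn with
  | nil => rw [reachVec_nil, hZ.inVec_eq]
  | append_singleton w q ih =>
    have hw' : w.length + 1 ≤ N := by simpa using hw
    apply hOR.injective_gammaBar hrank
    rw [reachVec_append_singleton, ih (by omega), Matrix.mulVecLin_apply, Matrix.mulVecLin_apply,
      Matrix.mulVec_mulVec, hZ.gammaBar_mul_A, hOR.gammaBar_mulVec, hOR.gammaShift_mulVec]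

theorem row_eq (hZ : Z.IsFactorizationOutput O R) (v : Words Q (N + 1)) (q : Q) (i : Fin p) :
    O (v, (q, i)) = (Z.sys.C q * Z.sys.prodA v.1) i := by
  obtain ⟨v, hv⟩ := v
  induction v with
  | nil => rw [LSS.prodA, Matrix.mul_one, hZ.C_row_eq]
  | cons a v ih =>
    have hv' : v.length ≤ N := by simpa using hv
    have hrow : gammaShift O a (⟨v, hv'⟩, (q, i)) =
        gammaBar O (⟨v, hv'⟩, (q, i)) ᵥ* Z.sys.A a := by
      rw [← hZ.gammaBar_mul_A]; rfl
    rw [LSS.prodA, ← Matrix.mul_assoc]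
    exact hrow.trans (congrArg (· ᵥ* Z.sys.A a) (ih (hv'.trans N.le_succ)))

theorem isPartialRealization (hZ : Z.IsFactorizationOutput O R)
    (hOR : IsFullRankFactorization O R) (hrank : RankCondition Φ N) :
    Z.IsPartialRealization (2 * N + 1) := by
  refine isPartialRealization_iff.2 fun q w hw j => funext fun i => ?_
  have h := hOR.mulVec_col_apply ⟨w.drop N, by simp; omega⟩ q i ⟨w.take N, by simp⟩ j
  rw [List.take_append_drop] at h
  rw [← h, ← hZ.reachVec_eq hOR hrank]
  conv_rhs => rw [← List.take_append_drop N w, reachVec_append, Matrix.mulVec_mulVec]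
  exact congrArg (· ⬝ᵥ _) (hZ.row_eq _ q i)

end Realization.IsFactorizationOutput

end Factorization

/-! ### One-sided calculus on `[0, ∞)` -/

section OneSided

variable {E : Type*} [NormedAddCommGroup E] [NormedSpace ℝ E] [CompleteSpace E]

theorem eventuallyEq_zero_of_iteratedDeriv_eq_zero {𝕜 F : Type*} [NontriviallyNormedField 𝕜]
    [CharZero 𝕜] [NormedAddCommGroup F] [NormedSpace 𝕜 F] [CompleteSpace F] {g : 𝕜 → F} {x : 𝕜}
    (hg : AnalyticAt 𝕜 g x) (h : ∀ n, iteratedDeriv n g x = 0) : g =ᶠ[𝓝 x] 0 :=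
  analyticOrderAt_eq_top.1 <| ENat.eq_top_iff_forall_ge.2 fun _ =>
    (natCast_le_analyticOrderAt_iff_iteratedDeriv_eq_zero hg).2 fun i _ => h i

theorem eventuallyEq_zero_of_iteratedDerivWithin_eq_zero {f : ℝ → E} {a : ℝ}
    (hf : AnalyticOn ℝ f (Ici a)) (h : ∀ n, iteratedDerivWithin n f (Ici a) a = 0) :
    f =ᶠ[𝓝[≥] a] 0 := by
  obtain ⟨g, -, hfg, hg⟩ := (hf a self_mem_Ici).exists_analyticAt
  rw [insert_eq_of_mem self_mem_Ici] at hfg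
  have hg_zero : g =ᶠ[𝓝 a] 0 := eventuallyEq_zero_of_iteratedDeriv_eq_zero hg fun n => by
    rw [← iteratedDerivWithin_eq_iteratedDeriv (uniqueDiffOn_Ici a) hg.contDiffAt self_mem_Ici,
      ← iteratedDerivWithin_congr hfg self_mem_Ici, h]
  exact hfg.eventuallyEq_nhdsWithin.trans (hg_zero.filter_mono nhdsWithin_le_nhds)

theorem eqOn_zero_of_iteratedDerivWithin_eq_zero {f : ℝ → E} {a : ℝ}
    (hf : AnalyticOn ℝ f (Ici a)) (h : ∀ n, iteratedDerivWithin n f (Ici a) a = 0) :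
    EqOn f 0 (Ici a) := by
  obtain ⟨b, hab, hb⟩ := mem_nhdsGE_iff_exists_Ico_subset.1
    (eventuallyEq_zero_of_iteratedDerivWithin_eq_zero hf h)
  have hIoi : EqOn f 0 (Ioi a) := by
    obtain ⟨c, hac, hcb⟩ := exists_between (mem_Ioi.1 hab)
    refine (isOpen_Ioi.analyticOn_iff_analyticOnNhd.1
      (hf.mono Ioi_subset_Ici_self)).eqOn_zero_of_preconnected_of_eventuallyEq_zero
      isPreconnected_Ioi hac ?_
    filter_upwards [Ioo_mem_nhds hac hcb] with y hy
    exact hb ⟨hy.1.le, hy.2⟩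
  intro s hs
  rcases eq_or_lt_of_le (mem_Ici.1 hs) with rfl | hs
  · exact hb ⟨le_rfl, hab⟩
  · exact hIoi hs

theorem eqOn_of_iteratedDerivWithin_eq {f g : ℝ → E} {a : ℝ} (hf : AnalyticOn ℝ f (Ici a))
    (hg : AnalyticOn ℝ g (Ici a))
    (h : ∀ n, iteratedDerivWithin n f (Ici a) a = iteratedDerivWithin n g (Ici a) a) :
    EqOn f g (Ici a) := fun s hs =>
  sub_eq_zero.1 <| eqOn_zero_of_iteratedDerivWithin_eq_zero (hf.sub hg) (fun n => by
    rw [iteratedDerivWithin_sub self_mem_Ici (uniqueDiffOn_Ici a)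
      ((hf.contDiffOn (uniqueDiffOn_Ici a)) a self_mem_Ici)
      ((hg.contDiffOn (uniqueDiffOn_Ici a)) a self_mem_Ici), h, sub_self]) hs

theorem hasDerivWithinAt_integral_Ici {g : ℝ → E} {a : ℝ} (hg : ContinuousOn g (Ici a)) :
    HasDerivWithinAt (fun t => ∫ s in a..t, g s) (g a) (Ici a) a := by
  have hc : Continuous fun s : ℝ => g (max s a) :=
    hg.comp_continuous (by fun_prop) fun s => le_max_right s a
  have hderiv := (hc.integral_hasStrictDerivAt a a).hasDerivAt.hasDerivWithinAt (s := Ici a)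
  rw [max_self] at hderiv
  refine hderiv.congr_of_mem (fun t (ht : a ≤ t) => ?_) self_mem_Ici
  refine intervalIntegral.integral_congr fun s hs => ?_
  rw [uIcc_of_le ht] at hs
  simp only [max_eq_left hs.1]

theorem integral_eq_add_integral_integral {F D : ℝ → ℝ → E}
    (hF : ContinuousOn (fun s => F s 0) (Ici 0)) (hD : Continuous (Function.uncurry D))
    (hder : ∀ s ∈ Ici (0 : ℝ), ∀ τ ∈ Ici (0 : ℝ), HasDerivWithinAt (F s) (D s τ) (Ici 0) τ)
    {t τ : ℝ} (ht : 0 ≤ t) (hτ : 0 ≤ τ) :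
    ∫ s in (0 : ℝ)..t, F s τ =
      (∫ s in (0 : ℝ)..t, F s 0) + ∫ σ in (0 : ℝ)..τ, ∫ s in (0 : ℝ)..t, D s σ := by
  have hFTC : ∀ s ∈ uIcc 0 t, F s τ = F s 0 + ∫ σ in (0 : ℝ)..τ, D s σ := by
    rw [uIcc_of_le ht]
    intro s hs
    have hDs : Continuous (D s) := hD.comp (by fun_prop : Continuous fun σ => (s, σ))
    rw [intervalIntegral.integral_eq_sub_of_hasDeriv_right_of_le hτ
      (fun σ hσ => ((hder s hs.1 σ hσ.1).continuousWithinAt).mono Icc_subset_Ici_self)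
      (fun σ hσ => (hder s hs.1 σ hσ.1.le).mono (Ioi_subset_Ici hσ.1.le))
      (hDs.intervalIntegrable _ _), add_sub_cancel]
  have hswap := MeasureTheory.intervalIntegral_intervalIntegral_swap (F := D)
    ((hD.continuousOn.integrableOn_compact (isCompact_uIcc.prod isCompact_uIcc)).mono_set
      (prod_mono (uIoc_subset_uIcc (a := 0) (b := t)) (uIoc_subset_uIcc (a := 0) (b := τ))))
  rw [intervalIntegral.integral_congr hFTC, intervalIntegral.integral_add, hswap]
  · exact (hF.mono (uIcc_of_le ht ▸ Icc_subset_Ici_self)).intervalIntegrable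
  · exact (intervalIntegral.continuous_parametric_intervalIntegral_of_continuous'
      hD 0 τ).intervalIntegrable _ _

theorem hasDerivWithinAt_integral_of_continuousOn {F D : ℝ → ℝ → E}
    (hF : ContinuousOn (fun s => F s 0) (Ici 0))
    (hD : ContinuousOn (Function.uncurry D) (Ici 0 ×ˢ Ici 0))
    (hder : ∀ s ∈ Ici (0 : ℝ), ∀ τ ∈ Ici (0 : ℝ), HasDerivWithinAt (F s) (D s τ) (Ici 0) τ)
    {t : ℝ} (ht : 0 ≤ t) :
    HasDerivWithinAt (fun τ => ∫ s in (0 : ℝ)..t, F s τ) (∫ s in (0 : ℝ)..t, D s 0)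
      (Ici 0) 0 := by
  let D' : ℝ → ℝ → E := fun s σ => D (max s 0) (max σ 0)
  have hD' : Continuous (Function.uncurry D') :=
    hD.comp_continuous (f := fun z : ℝ × ℝ => (max z.1 0, max z.2 0)) (by fun_prop) fun z =>
      ⟨le_max_right z.1 0, le_max_right z.2 0⟩
  have hder' : ∀ s ∈ Ici (0 : ℝ), ∀ τ ∈ Ici (0 : ℝ),
      HasDerivWithinAt (F s) (D' s τ) (Ici 0) τ := fun s hs τ hτ => by
    simpa only [D', max_eq_left (mem_Ici.1 hs), max_eq_left (mem_Ici.1 hτ)] using hder s hs τ hτ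
  have hg : Continuous fun σ => ∫ s in (0 : ℝ)..t, D' s σ :=
    intervalIntegral.continuous_parametric_intervalIntegral_of_continuous'
      (f := fun σ s => D' s σ) (hD'.comp continuous_swap) 0 t
  have hD0 : ∫ s in (0 : ℝ)..t, D' s 0 = ∫ s in (0 : ℝ)..t, D s 0 :=
    intervalIntegral.integral_congr fun s hs => by
      rw [uIcc_of_le ht] at hs
      simp only [D', max_eq_left hs.1, max_self]
  rw [← hD0]
  exact ((hasDerivWithinAt_integral_Ici hg.continuousOn).const_add _).congr_of_mem
    (fun τ hτ => integral_eq_add_integral_integral hF hD' hder' ht hτ) self_mem_Ici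

end OneSided

/-! ### Analytic functionals of switching sequences -/

section WordFunctionals

variable {Q V E E' : Type*} [NormedAddCommGroup V] [NormedSpace ℝ V]
  [NormedAddCommGroup E'] [NormedSpace ℝ E'] [NormedAddCommGroup E] [NormedSpace ℝ E]

/-- A switching sequence with a fixed word of modes whose times are nonnegative analytic functions
of a parameter in `s`. -/
def AnalyticTimesOn (ℓ : V → List (Q × ℝ≥0)) (s : Set V) : Prop :=
  ∃ L : List (Q × (V → ℝ)), (∀ x ∈ L, AnalyticOn ℝ x.2 s ∧ ∀ y ∈ s, 0 ≤ x.2 y) ∧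
    ∀ y, ℓ y = L.map fun x => (x.1, (x.2 y).toNNReal)

namespace AnalyticTimesOn

variable {s : Set V}

theorem const (v : List (Q × ℝ≥0)) : AnalyticTimesOn (fun _ : V => v) s := by
  refine ⟨v.map fun x => (x.1, fun _ => x.2), fun x hx => ?_, fun y => ?_⟩
  · obtain ⟨a, -, rfl⟩ := List.mem_map.1 hx
    exact ⟨analyticOn_const, fun _ _ => a.2.2⟩
  · simp [Function.comp_def]

theorem append {ℓ ℓ' : V → List (Q × ℝ≥0)} (hℓ : AnalyticTimesOn ℓ s)
    (hℓ' : AnalyticTimesOn ℓ' s) : AnalyticTimesOn (fun y => ℓ y ++ ℓ' y) s := by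
  obtain ⟨L, hL, h⟩ := hℓ
  obtain ⟨L', hL', h'⟩ := hℓ'
  exact ⟨L ++ L', fun x hx => (List.mem_append.1 hx).elim (hL x) (hL' x),
    fun y => by simp only [h, h', List.map_append]⟩

theorem timed {w : List Q} {t : V → Fin w.length → ℝ} (ht : AnalyticOn ℝ t s)
    (hs : MapsTo t s (Ici 0)) : AnalyticTimesOn (fun y => timed w (t y)) s := by
  refine ⟨List.ofFn fun i => (w.get i, fun y => t y i), fun x hx => ?_, fun y => ?_⟩
  · obtain ⟨i, rfl⟩ := List.mem_ofFn.1 hx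
    exact ⟨analyticOn_pi_iff.1 ht i, fun y hy => hs hy i⟩
  · rw [List.map_ofFn]
    rfl

theorem singleton (a : Q) {t : V → ℝ} (ht : AnalyticOn ℝ t s) (hs : MapsTo t s (Ici 0)) :
    AnalyticTimesOn (fun y => [(a, (t y).toNNReal)]) s :=
  ⟨[(a, t)], by simpa only [List.forall_mem_singleton] using ⟨ht, hs⟩, fun _ => rfl⟩

end AnalyticTimesOn

/-- `h ((q₁,t₁)⋯(q_k,t_k))` is analytic in the times, for each word `q₁⋯q_k`. -/
def WordAnalytic (h : List (Q × ℝ≥0) → E) : Prop :=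
  ∀ w : List Q, AnalyticOn ℝ (fun t : Fin w.length → ℝ => h (timed w t)) (Ici 0)

/-- The derivative at `0` with respect to an additional stay in `b` at the end. -/
noncomputable def wordDeriv (b : Q) (h : List (Q × ℝ≥0) → E) (v : List (Q × ℝ≥0)) : E :=
  derivWithin (fun t : ℝ => h (v ++ [(b, t.toNNReal)])) (Ici 0) 0

theorem uniqueDiffOn_Ici_pi {ι : Type*} (a : ι → ℝ) : UniqueDiffOn ℝ (Ici a) := by
  rw [← Set.pi_univ_Ici]
  exact UniqueDiffOn.univ_pi fun _ => uniqueDiffOn_Ici _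

theorem hasDerivWithinAt_snd {F : V × ℝ → E} {s : Set V} {I : Set ℝ} {x : V} {τ : ℝ}
    (hx : x ∈ s) (hF : DifferentiableWithinAt ℝ F (s ×ˢ I) (x, τ)) :
    HasDerivWithinAt (fun t => F (x, t)) (fderivWithin ℝ F (s ×ˢ I) (x, τ) (0, 1)) I τ :=
  hF.hasFDerivWithinAt.comp_hasDerivWithinAt τ
    ((hasDerivWithinAt_const τ I x).prodMk (hasDerivWithinAt_id τ I)) fun _ ht => ⟨hx, ht⟩

namespace WordAnalytic

variable {h : List (Q × ℝ≥0) → E}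

theorem comp (hh : WordAnalytic h) {ℓ : V → List (Q × ℝ≥0)} {s : Set V}
    (hℓ : AnalyticTimesOn ℓ s) : AnalyticOn ℝ (fun y => h (ℓ y)) s := by
  obtain ⟨L, hL, hℓ⟩ := hℓ
  let t : V → Fin (L.map Prod.fst).length → ℝ := fun y i => (L[i.1]'(by simpa using i.2)).2 y
  have hℓt : ∀ y, ℓ y = timed (L.map Prod.fst) (t y) := fun y => by
    rw [hℓ]
    apply List.ext_getElem <;> simp [timed, t]
  simp_rw [hℓt]
  exact (hh (L.map Prod.fst)).comp (AnalyticOn.pi fun i => (hL _ (List.getElem_mem _)).1)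
    fun y hy i => (hL _ (List.getElem_mem _)).2 y hy

theorem clm_apply (hh : WordAnalytic h) (L : E →L[ℝ] E') : WordAnalytic fun v => L (h v) :=
  fun w => (L.analyticOnNhd univ).comp_analyticOn (hh w) (mapsTo_univ _ _)

theorem append_right (hh : WordAnalytic h) (v : List (Q × ℝ≥0)) :
    WordAnalytic fun w => h (w ++ v) :=
  fun _ => hh.comp ((AnalyticTimesOn.timed analyticOn_id (mapsTo_id _)).append (.const v))

theorem append_left (hh : WordAnalytic h) (v : List (Q × ℝ≥0)) :
    WordAnalytic fun w => h (v ++ w) :=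
  fun _ => hh.comp ((AnalyticTimesOn.const v).append (.timed analyticOn_id (mapsTo_id _)))

theorem analyticOn_append_singleton (hh : WordAnalytic h) (v : List (Q × ℝ≥0)) (b : Q) :
    AnalyticOn ℝ (fun t : ℝ => h (v ++ [(b, t.toNNReal)])) (Ici 0) :=
  hh.comp ((AnalyticTimesOn.const v).append (.singleton b analyticOn_id (mapsTo_id _)))

theorem hasDerivWithinAt_wordDeriv (hh : WordAnalytic h) (v : List (Q × ℝ≥0)) (b : Q) :
    HasDerivWithinAt (fun t : ℝ => h (v ++ [(b, t.toNNReal)])) (wordDeriv b h v) (Ici 0) 0 :=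
  ((hh.analyticOn_append_singleton v b).differentiableOn 0 self_mem_Ici).hasDerivWithinAt

theorem wordDeriv (hh : WordAnalytic h) (b : Q) : WordAnalytic (wordDeriv b h) := by
  intro w
  let F : (Fin w.length → ℝ) × ℝ → E := fun z => h (timed w z.1 ++ [(b, z.2.toNNReal)])
  have hF : AnalyticOn ℝ F (Ici 0 ×ˢ Ici 0) :=
    hh.comp ((AnalyticTimesOn.timed analyticOn_fst fun _ hz => hz.1).append
      (.singleton b analyticOn_snd fun _ hz => hz.2))
  have hF' : AnalyticOn ℝ (fun t : Fin w.length → ℝ =>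
      fderivWithin ℝ F (Ici 0 ×ˢ Ici 0) (t, 0)) (Ici 0) :=
    (hF.fderivWithin ((uniqueDiffOn_Ici_pi 0).prod (uniqueDiffOn_Ici 0))).comp
      (analyticOn_id.prod analyticOn_const) fun _ ht => ⟨ht, self_mem_Ici⟩
  refine (((ContinuousLinearMap.apply ℝ E ((0 : Fin w.length → ℝ), (1 : ℝ))).analyticOnNhd
    univ).comp_analyticOn hF' (mapsTo_univ _ _)).congr fun t ht => ?_
  exact (hasDerivWithinAt_snd ht (hF.differentiableOn _ ⟨ht, self_mem_Ici⟩)).derivWithin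
    (uniqueDiffOn_Ici 0 0 self_mem_Ici)

end WordAnalytic

/-- The mixed derivative at `0` along a word. -/
noncomputable def wordCoeff : List Q → (List (Q × ℝ≥0) → E) → E
  | [], h => h []
  | a :: w, h => derivWithin (fun t : ℝ => wordCoeff w fun v => h ((a, t.toNNReal) :: v)) (Ici 0) 0

theorem timed_cons (a : Q) (w : List Q) (t : Fin (w.length + 1) → ℝ) :
    timed (a :: w) t = (a, (t 0).toNNReal) :: timed w (fun i => t i.succ) := by
  simp [timed, List.ofFn_succ]

theorem mixedDeriv_timed (w : List Q) (h : List (Q × ℝ≥0) → E) :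
    mixedDeriv w.length (fun t => h (timed w t)) = wordCoeff w h := by
  induction w generalizing h with
  | nil => rfl
  | cons a w ih => simp [mixedDeriv, timed_cons, wordCoeff, ← ih]

theorem wordCoeff_append_singleton (w : List Q) (b : Q) (h : List (Q × ℝ≥0) → E) :
    wordCoeff (w ++ [b]) h = wordCoeff w (wordDeriv b h) := by
  induction w generalizing h with
  | nil => rfl
  | cons a w ih =>
    simp only [List.cons_append, wordCoeff, ih]
    rfl

theorem wordCoeff_iterate_wordDeriv_eq {h g : List (Q × ℝ≥0) → E}
    (hhg : ∀ w, wordCoeff w h = wordCoeff w g) (a : Q) (n : ℕ) (w : List Q) :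
    wordCoeff w ((wordDeriv a)^[n] h) = wordCoeff w ((wordDeriv a)^[n] g) := by
  induction n generalizing h g with
  | zero => exact hhg w
  | succ _ ih => exact ih fun w => by simpa only [wordCoeff_append_singleton] using hhg (w ++ [a])

/-- A function of switching sequences with the defining properties of the kernels: it is analytic in
the times, consecutive stays in the same mode can be merged, and stays of length zero be deleted. -/
structure IsWordKernel (h : List (Q × ℝ≥0) → E) : Prop where
  analytic : WordAnalytic h
  merge : ∀ (w v : List (Q × ℝ≥0)) (q : Q) (t t' : ℝ≥0),
    h (w ++ (q, t) :: (q, t') :: v) = h (w ++ (q, t + t') :: v)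
  delete : ∀ (v w : List (Q × ℝ≥0)) (q : Q), h (v ++ (q, 0) :: w) = h (v ++ w)

namespace IsWordKernel

variable {h g : List (Q × ℝ≥0) → E}

theorem clm_apply (hh : IsWordKernel h) (L : E →L[ℝ] E') : IsWordKernel fun v => L (h v) where
  analytic := hh.analytic.clm_apply L
  merge w v q t t' := by rw [hh.merge]
  delete v w q := by rw [hh.delete]

theorem derivWithin_append_singleton (hh : IsWordKernel h) (v : List (Q × ℝ≥0)) (a : Q) {s : ℝ}
    (hs : 0 ≤ s) : derivWithin (fun t : ℝ => h (v ++ [(a, t.toNNReal)])) (Ici 0) s =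
      LinSwitch.wordDeriv a h (v ++ [(a, s.toNNReal)]) := by
  have hderiv := ((hh.analytic.analyticOn_append_singleton v a).differentiableOn s
    hs).hasDerivWithinAt.scomp_of_eq (0 : ℝ) ((hasDerivWithinAt_id 0 (Ici 0)).const_add s)
    (fun δ (hδ : 0 ≤ δ) => add_nonneg hs hδ) (add_zero s).symm
  rw [one_smul] at hderiv
  refine (HasDerivWithinAt.derivWithin (hderiv.congr_of_mem (fun δ hδ => ?_) self_mem_Ici)
    (uniqueDiffOn_Ici 0 0 self_mem_Ici)).symm
  simp [hh.merge, Real.toNNReal_add hs hδ]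

theorem wordDeriv (hh : IsWordKernel h) (b : Q) : IsWordKernel (wordDeriv b h) where
  analytic := hh.analytic.wordDeriv b
  merge w v q t t' := by
    simp only [LinSwitch.wordDeriv, List.append_assoc, List.cons_append, hh.merge]
  delete v w q := by
    simp only [LinSwitch.wordDeriv, List.append_assoc, List.cons_append, hh.delete]

theorem iteratedDerivWithin_append_singleton (hh : IsWordKernel h) (v : List (Q × ℝ≥0)) (a : Q)
    (n : ℕ) {s : ℝ} (hs : 0 ≤ s) :
    iteratedDerivWithin n (fun t : ℝ => h (v ++ [(a, t.toNNReal)])) (Ici 0) s =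
      (LinSwitch.wordDeriv a)^[n] h (v ++ [(a, s.toNNReal)]) := by
  induction n generalizing h with
  | zero => simp
  | succ n ih =>
    have heq : EqOn (derivWithin (fun t : ℝ => h (v ++ [(a, t.toNNReal)])) (Ici 0))
        (fun t => LinSwitch.wordDeriv a h (v ++ [(a, t.toNNReal)])) (Ici 0) :=
      fun t ht => hh.derivWithin_append_singleton v a ht
    rw [iteratedDerivWithin_succ', iteratedDerivWithin_congr heq hs, ih (hh.wordDeriv a)]
    rfl

theorem iterate_wordDeriv (hh : IsWordKernel h) (a : Q) (n : ℕ) :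
    IsWordKernel ((LinSwitch.wordDeriv a)^[n] h) := by
  induction n generalizing h with
  | zero => exact hh
  | succ _ ih => exact ih (hh.wordDeriv a)

theorem eq_of_wordCoeff_eq [CompleteSpace E] (hh : IsWordKernel h)
    (hg : IsWordKernel g) (hhg : ∀ w, wordCoeff w h = wordCoeff w g) : h = g := by
  ext1 v
  induction v using List.reverseRecOn generalizing h g with
  | nil => exact hhg []
  | append_singleton v x ih =>
    obtain ⟨a, s⟩ := x
    have heq := eqOn_of_iteratedDerivWithin_eq (hh.analytic.analyticOn_append_singleton v a)
      (hg.analytic.analyticOn_append_singleton v a) (fun n => ?_) s.coe_nonneg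
    · simpa only [Real.toNNReal_coe] using heq
    · rw [hh.iteratedDerivWithin_append_singleton v a n le_rfl,
        hg.iteratedDerivWithin_append_singleton v a n le_rfl, Real.toNNReal_zero,
        (hh.iterate_wordDeriv a n).delete, (hg.iterate_wordDeriv a n).delete, List.append_nil]
      exact ih (hh.iterate_wordDeriv a n) (hg.iterate_wordDeriv a n)
        (wordCoeff_iterate_wordDeriv_eq hhg a n)

end IsWordKernel

end WordFunctionals

/-! ### Mixed derivatives of integrals -/

section HasWordCoeff

variable {Q E : Type*} [NormedAddCommGroup E] [NormedSpace ℝ E]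

/-- `h` has the mixed derivative `c` along a word: all the one-sided derivatives which are taken
successively in `wordCoeff` exist. -/
def HasWordCoeff : List Q → (List (Q × ℝ≥0) → E) → E → Prop
  | [], h, c => h [] = c
  | a :: w, h, c => ∃ φ : ℝ → E,
      (∀ t, 0 ≤ t → HasWordCoeff w (fun v => h ((a, t.toNNReal) :: v)) (φ t)) ∧
        HasDerivWithinAt φ c (Ici 0) 0

namespace HasWordCoeff

theorem add {w : List Q} {h g : List (Q × ℝ≥0) → E} {c d : E}
    (hh : HasWordCoeff w h c) (hg : HasWordCoeff w g d) :
    HasWordCoeff w (fun v => h v + g v) (c + d) := by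
  induction w generalizing h g c d with
  | nil => exact congrArg₂ (· + ·) hh hg
  | cons a w ih =>
    obtain ⟨φ, hφ, hφc⟩ := hh
    obtain ⟨ψ, hψ, hψd⟩ := hg
    exact ⟨fun t => φ t + ψ t, fun t ht => ih (hφ t ht) (hψ t ht), hφc.add hψd⟩

theorem wordCoeff_eq {w : List Q} {h : List (Q × ℝ≥0) → E} {c : E}
    (hh : HasWordCoeff w h c) : wordCoeff w h = c := by
  induction w generalizing h c with
  | nil => exact hh
  | cons a w ih =>
    obtain ⟨φ, hφ, hφc⟩ := hh
    exact (hφc.congr_of_mem (fun t ht => ih (hφ t ht)) self_mem_Ici).derivWithin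
      (uniqueDiffOn_Ici 0 0 self_mem_Ici)

theorem append_singleton {w : List Q} {b : Q} {h h' : List (Q × ℝ≥0) → E} {c : E}
    (hd : ∀ v, HasDerivWithinAt (fun t : ℝ => h (v ++ [(b, t.toNNReal)])) (h' v) (Ici 0) 0)
    (hh' : HasWordCoeff w h' c) : HasWordCoeff (w ++ [b]) h c := by
  induction w generalizing h h' c with
  | nil => exact ⟨fun t => h [(b, t.toNNReal)], fun _ _ => rfl, hh' ▸ hd []⟩
  | cons a w ih =>
    obtain ⟨φ, hφ, hφc⟩ := hh'
    exact ⟨φ, fun t ht => ih (fun v => hd (_ :: v)) (hφ t ht), hφc⟩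

end HasWordCoeff

namespace WordAnalytic

variable {h : List (Q × ℝ≥0) → E}

theorem hasWordCoeff (hh : WordAnalytic h) (w : List Q) : HasWordCoeff w h (wordCoeff w h) := by
  induction w using List.reverseRecOn generalizing h with
  | nil => rfl
  | append_singleton w b ih =>
    rw [wordCoeff_append_singleton]
    exact .append_singleton (hh.hasDerivWithinAt_wordDeriv · b) (ih (hh.wordDeriv b))

theorem analyticOn_wordCoeff_cons (hh : WordAnalytic h) (a : Q) (w : List Q) :
    AnalyticOn ℝ (fun s : ℝ => wordCoeff w fun v => h ((a, s.toNNReal) :: v)) (Ici 0) := by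
  induction w using List.reverseRecOn generalizing h with
  | nil => exact hh.analyticOn_append_singleton [] a
  | append_singleton w b ih =>
    simp_rw [wordCoeff_append_singleton]
    exact ih (hh.wordDeriv b)

variable [CompleteSpace E]

theorem hasDerivWithinAt_integral_wordDeriv (hh : WordAnalytic h) (a b : Q)
    (v : List (Q × ℝ≥0)) {t : ℝ} (ht : 0 ≤ t) :
    HasDerivWithinAt (fun τ : ℝ => ∫ s in 0..t, h ((a, s.toNNReal) :: v ++ [(b, τ.toNNReal)]))
      (∫ s in 0..t, LinSwitch.wordDeriv b h ((a, s.toNNReal) :: v)) (Ici 0) 0 := by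
  let F : ℝ × ℝ → E := fun z => h ((a, z.1.toNNReal) :: v ++ [(b, z.2.toNNReal)])
  have hF : AnalyticOn ℝ F (Ici 0 ×ˢ Ici 0) :=
    hh.comp (((AnalyticTimesOn.singleton a analyticOn_fst fun _ hz => hz.1).append
      (.const v)).append (.singleton b analyticOn_snd fun _ hz => hz.2))
  have hF₀ : ContinuousOn (fun s => F (s, 0)) (Ici 0) :=
    hF.continuousOn.comp (by fun_prop) fun s hs => ⟨hs, self_mem_Ici⟩
  have hF' : ContinuousOn (Function.uncurry fun s τ =>
      fderivWithin ℝ F (Ici 0 ×ˢ Ici 0) (s, τ) (0, 1)) (Ici 0 ×ˢ Ici 0) :=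
    (hF.fderivWithin ((uniqueDiffOn_Ici 0).prod (uniqueDiffOn_Ici 0))).continuousOn.clm_apply
      continuousOn_const
  have hder : ∀ s ∈ Ici (0 : ℝ), ∀ τ ∈ Ici (0 : ℝ), HasDerivWithinAt (fun τ => F (s, τ))
      (fderivWithin ℝ F (Ici 0 ×ˢ Ici 0) (s, τ) (0, 1)) (Ici 0) τ := fun s hs τ hτ =>
    hasDerivWithinAt_snd hs (hF.differentiableOn _ ⟨hs, hτ⟩)
  refine (hasDerivWithinAt_integral_of_continuousOn hF₀ hF' hder ht).congr_deriv
    (intervalIntegral.integral_congr fun s hs => ?_)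
  rw [uIcc_of_le ht] at hs
  exact (uniqueDiffOn_Ici (0 : ℝ) 0 self_mem_Ici).eq_deriv _ (hder s hs.1 0 self_mem_Ici)
    (hh.hasDerivWithinAt_wordDeriv ((a, s.toNNReal) :: v) b)

theorem hasWordCoeff_integral (hh : WordAnalytic h) (a : Q) (w : List Q) {t : ℝ} (ht : 0 ≤ t) :
    HasWordCoeff w (fun v => ∫ s in 0..t, h ((a, s.toNNReal) :: v))
      (∫ s in 0..t, wordCoeff w fun v => h ((a, s.toNNReal) :: v)) := by
  induction w using List.reverseRecOn generalizing h with
  | nil => rfl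
  | append_singleton w b ih =>
    simp_rw [wordCoeff_append_singleton]
    exact .append_singleton (hh.hasDerivWithinAt_integral_wordDeriv a b · ht)
      (ih (hh.wordDeriv b))

end WordAnalytic

end HasWordCoeff

/-! ### Kernel representations of single input-output maps -/

section KernelInt

variable {Q F E : Type*} [NormedAddCommGroup F] [NormedSpace ℝ F] [NormedAddCommGroup E]
  [NormedSpace ℝ E]

/-- The contribution to the output of the input `u`, fed in from time `τ` on, where `H q v` is the
response to an impulse which is given at the beginning of `v` in the mode `q`. -/
noncomputable def kernelInt (H : Q → List (Q × ℝ≥0) → F →L[ℝ] E) (u : ℝ≥0 → F) :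
    ℝ≥0 → List (Q × ℝ≥0) → E
  | _, [] => 0
  | τ, (q, t) :: w =>
    (∫ s in (0 : ℝ)..t, H q ((q, ((t : ℝ) - s).toNNReal) :: w) (u (s.toNNReal + τ))) +
      kernelInt H u (τ + t) w

variable {H : Q → List (Q × ℝ≥0) → F →L[ℝ] E}

theorem kernelInt_zero (τ : ℝ≥0) (w : List (Q × ℝ≥0)) : kernelInt H (fun _ => 0) τ w = 0 := by
  induction w generalizing τ with
  | nil => rfl
  | cons x w ih => simp only [kernelInt, map_zero, intervalIntegral.integral_zero, ih, add_zero]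

theorem kernelInt_append_zero
    (hH : ∀ (q₀ q : Q) (v : List (Q × ℝ≥0)), H q₀ (v ++ [(q, 0)]) = H q₀ v)
    (u : ℝ≥0 → F) (τ : ℝ≥0) (v : List (Q × ℝ≥0)) (q : Q) :
    kernelInt H u τ (v ++ [(q, 0)]) = kernelInt H u τ v := by
  induction v generalizing τ with
  | nil => simp [kernelInt]
  | cons x v ih =>
    obtain ⟨q₀, t⟩ := x
    have hhead : ∀ t', H q₀ ((q₀, t') :: (v ++ [(q, 0)])) = H q₀ ((q₀, t') :: v) :=
      fun t' => hH q₀ q ((q₀, t') :: v)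
    simp only [List.cons_append, kernelInt, ih, hhead]

theorem sum_integral_eq_kernelInt {m p : ℕ} {G : List (Q × ℝ≥0) → Matrix (Fin p) (Fin m) ℝ}
    {H : Q → List (Q × ℝ≥0) → (Fin m → ℝ) →L[ℝ] (Fin p → ℝ)} {q : Q}
    (hGH : ∀ (q₀ : Q) (t₀ t : ℝ≥0) (v v' : List (Q × ℝ≥0)), (q₀, t₀) :: v = v' ++ [(q, t)] →
      ∀ e, G ((q₀, t₀) :: v) *ᵥ e = H q₀ ((q₀, t₀) :: v) e)
    (u : ℝ≥0 → Fin m → ℝ) (τ : ℝ≥0) {w v : List (Q × ℝ≥0)} {t : ℝ≥0} (hw : w = v ++ [(q, t)]) :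
    ∑ i : Fin w.length, ∫ s in (0 : ℝ)..((w.get i).2 : ℝ),
        G (((w.get i).1, (((w.get i).2 : ℝ) - s).toNNReal) :: w.drop (i + 1)) *ᵥ
          u (s.toNNReal + (τ + ((w.take i).map Prod.snd).sum)) = kernelInt H u τ w := by
  induction v generalizing τ w with
  | nil =>
    subst hw
    simp [kernelInt, hGH q _ _ [] [] rfl]
  | cons x v ih =>
    subst hw
    obtain ⟨q₀, t₀⟩ := x
    have hhead : ∀ t' e, G ((q₀, t') :: (v ++ [(q, t)])) *ᵥ e =
      H q₀ ((q₀, t') :: (v ++ [(q, t)])) e := fun t' => hGH q₀ t' t _ ((q₀, t') :: v) rfl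
    rw [List.cons_append, kernelInt, ← ih (τ + t₀) rfl]
    refine (Fin.sum_univ_succ (n := (v ++ [(q, t)]).length) _).trans ?_
    simp [hhead, add_assoc]

variable [CompleteSpace E] {e : F}

theorem hasWordCoeff_cons_kernelInt (hH : ∀ q, WordAnalytic fun v => H q v e) {w : List Q} {c : E}
    (hc : ∀ τ, HasWordCoeff w (kernelInt H (fun _ => e) τ) c) (τ : ℝ≥0) (a : Q) :
    HasWordCoeff (a :: w) (kernelInt H (fun _ => e) τ)
      (wordCoeff w fun v => H a ((a, 0) :: v) e) := by
  refine ⟨fun t => (∫ s in 0..t, wordCoeff w fun v => H a ((a, s.toNNReal) :: v) e) + c,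
    fun t ht => ?_, ?_⟩
  · convert ((hH a).hasWordCoeff_integral a w ht).add (hc (τ + t.toNNReal)) using 2 with v
    rw [kernelInt, Real.coe_toNNReal t ht,
      intervalIntegral.integral_comp_sub_left (fun s => H a ((a, s.toNNReal) :: v) e),
      sub_self, sub_zero]
  · simpa only [Real.toNNReal_zero] using (hasDerivWithinAt_integral_Ici
      ((hH a).analyticOn_wordCoeff_cons a w).continuousOn).add_const c

theorem exists_hasWordCoeff_kernelInt (hH : ∀ q, WordAnalytic fun v => H q v e) (w : List Q) :
    ∃ c, ∀ τ, HasWordCoeff w (kernelInt H (fun _ => e) τ) c := by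
  induction w with
  | nil => exact ⟨0, fun _ => rfl⟩
  | cons a w ih =>
    obtain ⟨c, hc⟩ := ih
    exact ⟨_, fun τ => hasWordCoeff_cons_kernelInt hH hc τ a⟩

end KernelInt

section HasKernels

variable {Q : Type*} {m p : ℕ}

/-- `f` has the kernels `K` and `G` in the following normal form, which separates the first and the
last mode from the switching sequence between them: `K q v` stands for the kernel
`K^f (v (q, 0))` and `G q q₀ v` for `G ((q₀, 0) v (q, 0))`. -/
structure HasKernels (f : IOMap Q m p) (K : Q → List (Q × ℝ≥0) → (Fin p → ℝ))
    (G : Q → Q → List (Q × ℝ≥0) → (Fin m → ℝ) →L[ℝ] (Fin p → ℝ)) : Prop where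
  init : ∀ q, IsWordKernel (K q)
  input : ∀ q q₀ e, IsWordKernel fun v => G q q₀ v e
  apply_append : ∀ (u : PC m) (v : List (Q × ℝ≥0)) (q : Q) (t : ℝ≥0),
    f u ⟨v ++ [(q, t)], by simp⟩ = K q (v ++ [(q, t)]) + kernelInt (G q) u.1 0 (v ++ [(q, t)])

namespace HasKernels

variable {f f' : IOMap Q m p} {K K' : Q → List (Q × ℝ≥0) → (Fin p → ℝ)}
  {G G' : Q → Q → List (Q × ℝ≥0) → (Fin m → ℝ) →L[ℝ] (Fin p → ℝ)}

theorem apply_append_zero (h : HasKernels f K G) (u : PC m) (v : List (Q × ℝ≥0)) (q : Q) :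
    f u ⟨v ++ [(q, 0)], by simp⟩ = K q v + kernelInt (G q) u.1 0 v := by
  have hG : ∀ q₀ q' v, G q q₀ (v ++ [(q', 0)]) = G q q₀ v := fun q₀ q' v => by
    ext1 e
    simpa only [List.append_nil] using (h.input q q₀ e).delete v [] q'
  rw [h.apply_append, (h.init q).delete, List.append_nil, kernelInt_append_zero hG]

theorem mixedDeriv_alongWord (h : HasKernels f K G) (u : PC m) (w : List Q) (q : Q) :
    mixedDeriv w.length (alongWord f u w q) =
      wordCoeff w fun v => K q v + kernelInt (G q) u.1 0 v := by
  simp only [← h.apply_append_zero u, ← mixedDeriv_timed]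
  rfl

theorem markovInit_eq (h : HasKernels f K G) (q : Q) (w : List Q) :
    markovInit f q w = wordCoeff w (K q) := by
  rw [markovInit, h.mixedDeriv_alongWord]
  congr 1
  ext1 v
  exact (congrArg (K q v + ·) (kernelInt_zero 0 v)).trans (add_zero _)

theorem markovInputOf_eq (h : HasKernels f K G) (q q₀ : Q) (j : Fin m) (w : List Q) :
    markovInputOf f q q₀ j w = wordCoeff w fun v => G q q₀ v (Pi.single j 1) := by
  have hG := fun q₀ => (h.input q q₀ (Pi.single j 1)).analytic
  obtain ⟨c, hc⟩ := exists_hasWordCoeff_kernelInt hG w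
  have hinput := ((h.init q).analytic.hasWordCoeff (q₀ :: w)).add
    (hasWordCoeff_cons_kernelInt hG hc 0 q₀)
  have hinit := h.markovInit_eq q (q₀ :: w)
  rw [markovInit] at hinit
  have hdelete : (fun v => G q q₀ ((q₀, 0) :: v) (Pi.single j 1)) =
      fun v => G q q₀ v (Pi.single j 1) := funext fun v => (h.input q q₀ _).delete [] v q₀
  rw [markovInputOf, hinit, h.mixedDeriv_alongWord, sub_eq_iff_eq_add', ← hdelete]
  exact hinput.wordCoeff_eq

theorem eq_of_markov_eq (h : HasKernels f K G) (h' : HasKernels f' K' G')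
    (hinit : ∀ q w, markovInit f q w = markovInit f' q w)
    (hinput : ∀ q q₀ j w, markovInputOf f q q₀ j w = markovInputOf f' q q₀ j w) : f = f' := by
  have hK : K = K' := funext fun q => (h.init q).eq_of_wordCoeff_eq (h'.init q) fun w => by
    rw [← h.markovInit_eq, ← h'.markovInit_eq, hinit]
  have hG : G = G' := by
    ext1 q; ext1 q₀; ext1 v
    refine ContinuousLinearMap.coe_injective (LinearMap.pi_ext' fun j => LinearMap.ext_ring ?_)
    refine congrFun ((h.input q q₀ (Pi.single j 1)).eq_of_wordCoeff_eq
      (h'.input q q₀ (Pi.single j 1)) fun w => ?_) v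
    rw [← h.markovInputOf_eq, ← h'.markovInputOf_eq, hinput]
  subst hK hG
  ext1 u
  ext1 ⟨w, hw⟩
  obtain ⟨v, ⟨q, t⟩, rfl⟩ := (List.eq_nil_or_concat' w).resolve_left hw
  rw [h.apply_append, h'.apply_append]

end HasKernels

theorem wordAnalytic_append_singleton {E : Type*} [NormedAddCommGroup E] [NormedSpace ℝ E]
    {h : List (Q × ℝ≥0) → E} (hh : ∀ w : List Q, w ≠ [] →
      AnalyticOn ℝ (fun t : Fin w.length → ℝ => h (timed w t)) (Ici 0)) (x : Q × ℝ≥0) :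
    WordAnalytic fun v => h (v ++ [x]) := by
  classical
  have hite : WordAnalytic fun v => if v = [] then 0 else h v := by
    rintro (_ | ⟨a, w⟩)
    · exact analyticOn_const (𝕜 := ℝ) (v := (0 : E))
    · refine (hh (a :: w) (List.cons_ne_nil a w)).congr fun t _ => ?_
      simp only [timed_cons, reduceCtorEq, if_false]
  simpa using hite.append_right [x]

theorem HasKernelRepresentation.exists_hasKernels {Φ : Set (IOMap Q m p)}
    (hΦ : HasKernelRepresentation Φ) : ∃ G, ∀ f : Φ, ∃ K, HasKernels f.1 K G := by
  obtain ⟨K, G, hKan, hGan, hKmerge, hGmerge, hKdelete, hGdelete, hf⟩ := hΦ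
  have hGan' : ∀ q e, WordAnalytic fun v => G (v ++ [(q, 0)]) *ᵥ e := fun q e =>
    wordAnalytic_append_singleton (h := fun v => G v *ᵥ e) (fun w hw => AnalyticOn.pi fun i => by
      simp only [Matrix.mulVec, dotProduct]
      exact Finset.analyticOn_fun_sum _ fun j _ => (hGan w hw i j).mul analyticOn_const) (q, 0)
  refine ⟨fun q q₀ v => (G ((q₀, 0) :: v ++ [(q, 0)])).mulVecLin.toContinuousLinearMap,
    fun f => ⟨fun q v => K f (v ++ [(q, 0)]), fun q => ⟨wordAnalytic_append_singleton (hKan f) _,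
      fun w v a t t' => ?_, fun v w a => ?_⟩, fun q q₀ e => ⟨(hGan' q e).append_left [(q₀, 0)],
      fun w v a t t' => congrArg (· *ᵥ e) ?_, fun v w a => congrArg (· *ᵥ e) ?_⟩,
      fun u v q t => (hf f u _).trans (congrArg₂ (· + ·) ?_ ?_)⟩⟩
  · simpa using hKmerge f w (v ++ [(q, 0)]) a t t'
  · simpa using hKdelete f v (w ++ [(q, 0)]) a (by simp)
  · simpa using hGmerge ((q₀, 0) :: w) (v ++ [(q, 0)]) a t t'
  · simpa using hGdelete ((q₀, 0) :: v) (w ++ [(q, 0)]) a (by simp) (by simp)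
  · simpa using (hKmerge f v [] q t 0).symm
  · have hG : ∀ (q₀ : Q) (t₀ t : ℝ≥0) (v v' : List (Q × ℝ≥0)), (q₀, t₀) :: v = v' ++ [(q, t)] →
        G ((q₀, t₀) :: v) = G ((q₀, 0) :: ((q₀, t₀) :: v) ++ [(q, 0)]) := by
      intro q₀ t₀ t v v' hv
      have hfirst := hGmerge [] (v ++ [(q, 0)]) q₀ 0 t₀
      have hlast := hGmerge v' [] q t 0
      simp only [List.nil_append, zero_add, List.cons_append, add_zero] at hfirst hlast ⊢
      rw [hfirst, hv, ← hlast, ← List.cons_append, hv, List.append_assoc, List.singleton_append]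
    rw [← sum_integral_eq_kernelInt (q := q) (G := G)
      (fun q₀ t₀ t v v' hv e => congrArg (· *ᵥ e) (hG q₀ t₀ t v v' hv)) u.1 0 rfl]
    simp only [zero_add]

end HasKernels

/-! ### Flows of linear switched systems -/

section Flow

variable {Q : Type*} {n m p : ℕ}

/-- Multiplication by a matrix, as a continuous linear map. -/
noncomputable def mulVecCLM {k l : ℕ} (M : Matrix (Fin k) (Fin l) ℝ) :
    (Fin l → ℝ) →L[ℝ] (Fin k → ℝ) :=
  M.mulVecLin.toContinuousLinearMap

@[simp]
theorem mulVecCLM_apply {k l : ℕ} (M : Matrix (Fin k) (Fin l) ℝ) (x : Fin l → ℝ) :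
    mulVecCLM M x = M *ᵥ x :=
  rfl

namespace LSS

/-- The autonomous flow `e^{t A_q}`. -/
noncomputable def flow (sys : LSS Q n m p) (q : Q) (t : ℝ) : (Fin n → ℝ) →L[ℝ] (Fin n → ℝ) :=
  NormedSpace.exp (t • mulVecCLM (sys.A q))

/-- The autonomous flow `e^{t_k A_{q_k}} ⋯ e^{t₁ A_{q₁}}` along a switching sequence. -/
noncomputable def trans (sys : LSS Q n m p) :
    List (Q × ℝ≥0) → ((Fin n → ℝ) →L[ℝ] (Fin n → ℝ))
  | [] => 1
  | (q, t) :: w => sys.trans w * sys.flow q t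

variable (sys : LSS Q n m p)

theorem flow_zero (q : Q) : sys.flow q 0 = 1 := by
  rw [flow, zero_smul, NormedSpace.exp_zero]

theorem flow_add (q : Q) (s t : ℝ) : sys.flow q (s + t) = sys.flow q s * sys.flow q t := by
  let _ := NormedAlgebra.restrictScalars ℚ ℝ ((Fin n → ℝ) →L[ℝ] (Fin n → ℝ))
  rw [flow, flow, flow, add_smul]
  exact NormedSpace.exp_add_of_commute
    (((Commute.refl (mulVecCLM (sys.A q))).smul_left s).smul_right t)

theorem hasDerivAt_flow (q : Q) (t : ℝ) :
    HasDerivAt (sys.flow q) (mulVecCLM (sys.A q) * sys.flow q t) t :=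
  hasDerivAt_exp_smul_const' (mulVecCLM (sys.A q)) t

theorem continuous_flow (q : Q) : Continuous (sys.flow q) :=
  continuous_iff_continuousAt.2 fun t => (sys.hasDerivAt_flow q t).continuousAt

theorem mulVecCLM_mul_flow (q : Q) (t : ℝ) :
    mulVecCLM (sys.A q) * sys.flow q t = sys.flow q t * mulVecCLM (sys.A q) :=
  (hasDerivAt_exp_smul_const' (mulVecCLM (sys.A q)) t).unique
    (hasDerivAt_exp_smul_const (mulVecCLM (sys.A q)) t)

theorem analyticOn_flow (q : Q) (s : Set ℝ) : AnalyticOn ℝ (sys.flow q) s := fun t _ =>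
  (AnalyticAt.comp (f := fun t : ℝ => t • mulVecCLM (sys.A q))
    (NormedSpace.exp_analytic (𝕂 := ℝ) (t • mulVecCLM (sys.A q)))
    (by fun_prop)).analyticWithinAt

theorem trans_append (w v : List (Q × ℝ≥0)) :
    sys.trans (w ++ v) = sys.trans v * sys.trans w := by
  induction w with
  | nil => rw [List.nil_append, trans, mul_one]
  | cons x w ih => rw [List.cons_append, trans, trans, ih, mul_assoc]

theorem wordAnalytic_trans : WordAnalytic sys.trans := by
  intro w
  induction w with
  | nil => exact analyticOn_const
  | cons a w ih =>
    have hproj : ∀ i, AnalyticOn ℝ (fun t : Fin (w.length + 1) → ℝ => t i) (Ici 0) := fun i =>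
      (ContinuousLinearMap.proj (R := ℝ) (φ := fun _ => ℝ) i).analyticOn _
    have htail : AnalyticOn ℝ (fun t : Fin (w.length + 1) → ℝ =>
        sys.trans (timed w fun i => t i.succ)) (Ici 0) :=
      ih.comp (AnalyticOn.pi fun i => hproj i.succ) fun t ht i => ht i.succ
    have hhead : AnalyticOn ℝ (fun t : Fin (w.length + 1) → ℝ => sys.flow a (t 0)) (Ici 0) :=
      (sys.analyticOn_flow a univ).comp (hproj 0) (mapsTo_univ _ _)
    refine (htail.mul hhead).congr fun t ht => ?_
    rw [timed_cons, trans, Real.coe_toNNReal _ (ht 0)]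

theorem isWordKernel_trans : IsWordKernel sys.trans where
  analytic := sys.wordAnalytic_trans
  merge w v q t t' := by
    simp only [trans_append, trans, NNReal.coe_add, add_comm (t : ℝ), flow_add, mul_assoc]
  delete v w q := by
    simp only [trans_append, trans, NNReal.coe_zero, flow_zero, mul_one]

variable {E : Type*} [NormedAddCommGroup E] [NormedSpace ℝ E]

theorem isWordKernel_apply_trans (L : (Fin n → ℝ) →L[ℝ] E) (x : Fin n → ℝ) :
    IsWordKernel fun v => L (sys.trans v x) :=
  sys.isWordKernel_trans.clm_apply (L ∘L ContinuousLinearMap.apply ℝ (Fin n → ℝ) x)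

theorem wordDeriv_apply_trans (L : (Fin n → ℝ) →L[ℝ] E) (x : Fin n → ℝ) (b : Q) :
    wordDeriv b (fun v => L (sys.trans v x)) =
      fun v => (L ∘L mulVecCLM (sys.A b)) (sys.trans v x) := by
  ext1 v
  have hderiv := L.hasFDerivAt.comp_hasDerivAt (0 : ℝ)
    ((sys.hasDerivAt_flow b 0).clm_apply (hasDerivAt_const (0 : ℝ) (sys.trans v x)))
  simp only [flow_zero, mul_one, map_zero, add_zero] at hderiv
  refine HasDerivWithinAt.derivWithin (hderiv.hasDerivWithinAt.congr_of_mem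
    (fun t (ht : 0 ≤ t) => ?_) self_mem_Ici) (uniqueDiffOn_Ici 0 0 self_mem_Ici)
  simp [trans_append, trans, ht]

theorem wordCoeff_apply_trans (L : (Fin n → ℝ) →L[ℝ] E) (x : Fin n → ℝ) (w : List Q) :
    wordCoeff w (fun v => L (sys.trans v x)) = L (sys.prodA w *ᵥ x) := by
  induction w using List.reverseRecOn generalizing L with
  | nil => simp [wordCoeff, trans, prodA]
  | append_singleton w b ih =>
    rw [wordCoeff_append_singleton, wordDeriv_apply_trans, ih, prodA_append,
      ← Matrix.mulVec_mulVec]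
    simp [prodA]

end LSS

end Flow

/-! ### Variation of constants -/

namespace PC

open Bornology

variable {m : ℕ} (u : PC m)

theorem exists_isBounded_image_mem_nhds (r : ℝ≥0) : ∃ s ∈ 𝓝 r, IsBounded (u.1 '' s) := by
  by_cases hc : ContinuousAt u.1 r
  · exact Metric.exists_isBounded_image_of_tendsto hc
  · obtain ⟨⟨a, ha⟩, ⟨b, hb⟩⟩ := u.2.2 r hc
    obtain ⟨s, hs, hsb⟩ := Metric.exists_isBounded_image_of_tendsto ha
    obtain ⟨s', hs', hsb'⟩ := Metric.exists_isBounded_image_of_tendsto hb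
    refine ⟨s ∪ s' ∪ {r}, ?_, ?_⟩
    · rw [← nhdsNE_sup_pure, ← nhdsLT_sup_nhdsGT]
      exact union_mem_sup (union_mem_sup hs hs') (mem_singleton r)
    · rw [image_union, image_union, image_singleton]
      exact (hsb.union hsb').union isBounded_singleton

theorem isBounded_image {s : Set ℝ≥0} (hs : IsCompact s) : IsBounded (u.1 '' s) := by
  refine hs.induction_on (by simp) (fun _ _ hst ht => ht.subset (image_mono hst))
    (fun _ _ hs ht => ?_) fun r _ => ?_
  · rw [image_union]
    exact hs.union ht
  · obtain ⟨t, ht, htb⟩ := u.exists_isBounded_image_mem_nhds r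
    exact ⟨t, mem_nhdsWithin_of_mem_nhds ht, htb⟩

theorem exists_norm_le (T : ℝ≥0) : ∃ M, ∀ r ≤ T, ‖u.1 r‖ ≤ M := by
  obtain ⟨M, hM⟩ := (u.isBounded_image (isCompact_Icc (a := 0) (b := T))).exists_norm_le
  exact ⟨M, fun r hr => hM _ ⟨r, ⟨zero_le, hr⟩, rfl⟩⟩

theorem finite_discontinuities (τ : ℝ≥0) (t : ℝ) :
    {s ∈ Ioo 0 t | ¬ ContinuousAt (fun s : ℝ => u.1 (s.toNNReal + τ)) s}.Finite := by
  refine Set.Finite.of_finite_image (f := fun s : ℝ => s.toNNReal + τ)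
    ((u.2.1 (t.toNNReal + τ)).subset ?_) ?_
  · rintro _ ⟨s, ⟨hs, hc⟩, rfl⟩
    refine ⟨add_le_add_left (Real.toNNReal_le_toNNReal hs.2.le) τ, fun h => hc ?_⟩
    exact ContinuousAt.comp (f := fun s : ℝ => s.toNNReal + τ) h (by fun_prop)
  · rintro s ⟨hs, -⟩ s' ⟨hs', -⟩ h
    exact (Real.toNNReal_eq_toNNReal_iff hs.1.le hs'.1.le).1 (add_right_cancel h)

end PC

section Solutions

open MeasureTheory

variable {Q : Type*} {n m p : ℕ}

theorem intervalIntegrable_of_norm_le {E : Type*} [NormedAddCommGroup E] {g : ℝ → E} {a b : ℝ}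
    (hab : a ≤ b) (hg : {s ∈ Ioo a b | ¬ ContinuousAt g s}.Finite) {M : ℝ}
    (hM : ∀ s ∈ Ioo a b, ‖g s‖ ≤ M) : IntervalIntegrable g volume a b := by
  rw [intervalIntegrable_iff_integrableOn_Ioo_of_le hab]
  have hcont : ContinuousOn g (Ioo a b \ {s ∈ Ioo a b | ¬ ContinuousAt g s}) := fun s hs =>
    (not_not.1 fun h => hs.2 ⟨hs.1, h⟩ : ContinuousAt g s).continuousWithinAt
  have hmeas := hcont.aestronglyMeasurable (μ := volume)
    (measurableSet_Ioo.diff hg.measurableSet)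
  rw [Measure.restrict_congr_set (sdiff_null_ae_eq_self (hg.measure_zero _))] at hmeas
  exact IntegrableOn.of_bound (by simp) hmeas M
    ((ae_restrict_iff' measurableSet_Ioo).2 (ae_of_all _ hM))

namespace LSS

variable (sys : LSS Q n m p)

theorem intervalIntegrable_flow (q : Q) (u : PC m) (τ : ℝ≥0) {t : ℝ} (ht : 0 ≤ t)
    {θ : ℝ → ℝ} (hθ : Continuous θ) :
    IntervalIntegrable (fun s => sys.flow q (θ s) (sys.B q *ᵥ u.1 (s.toNNReal + τ)))
      volume 0 t := by
  obtain ⟨M, hM⟩ := u.exists_norm_le (t.toNNReal + τ)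
  have hc : Continuous fun s => sys.flow q (θ s) ∘L mulVecCLM (sys.B q) :=
    ((sys.continuous_flow q).comp hθ).clm_comp continuous_const
  obtain ⟨M', hM'⟩ := (isCompact_Icc (a := (0 : ℝ)) (b := t)).exists_bound_of_continuousOn
    hc.continuousOn
  refine intervalIntegrable_of_norm_le ht ((u.finite_discontinuities τ t).subset ?_)
    (M := M' * M) fun s hs => ?_
  · exact fun s hs => ⟨hs.1, fun hu => hs.2 (hc.continuousAt.clm_apply hu)⟩
  · refine ((sys.flow q (θ s) ∘L mulVecCLM (sys.B q)).le_opNorm _).trans ?_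
    have hnorm := hM' s (Ioo_subset_Icc_self hs)
    exact mul_le_mul hnorm (hM _ (add_le_add_left (Real.toNNReal_le_toNNReal hs.2.le) τ))
      (norm_nonneg _) ((norm_nonneg _).trans hnorm)

/-- The state after a stay of length `t` in the mode `q`, given by variation of constants; the
input `u` is read from time `τ` on. -/
noncomputable def step (q : Q) (u : PC m) (τ : ℝ≥0) (t : ℝ) (x : Fin n → ℝ) : Fin n → ℝ :=
  sys.flow q t x + ∫ s in (0 : ℝ)..t, sys.flow q (t - s) (sys.B q *ᵥ u.1 (s.toNNReal + τ))

theorem hasDerivAt_flow_sub_apply {q : Q} {v : ℝ → Fin m → ℝ} {ξ : ℝ → Fin n → ℝ} {s : ℝ}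
    (hξ : HasDerivAt ξ (sys.A q *ᵥ ξ s + sys.B q *ᵥ v s) s) (t : ℝ) :
    HasDerivAt (fun s => sys.flow q (t - s) (ξ s)) (sys.flow q (t - s) (sys.B q *ᵥ v s)) s := by
  have hflow : HasDerivAt (fun s => sys.flow q (t - s))
      (-(mulVecCLM (sys.A q) * sys.flow q (t - s))) s := by
    have h := (sys.hasDerivAt_flow q (t - s)).scomp s ((hasDerivAt_id s).const_sub t)
    simp only [neg_smul, one_smul] at h
    exact h
  refine (hflow.clm_apply hξ).congr_deriv ?_
  rw [sys.mulVecCLM_mul_flow]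
  simp

theorem eq_step_of_isSolution {q : Q} {u : PC m} {τ : ℝ≥0} {t : ℝ} (ht : 0 ≤ t)
    {ξ : ℝ → Fin n → ℝ}
    (hξ : IsSolution (sys.A q) (sys.B q) (fun s => u.1 (s.toNNReal + τ)) t ξ) :
    ξ t = sys.step q u τ t (ξ 0) := by
  have hθ : Continuous fun s => t - s := continuous_const.sub continuous_id
  have h := integral_eq_of_hasDerivAt_off_countable_of_le
    (fun s => sys.flow q (t - s) (ξ s))
    (fun s => sys.flow q (t - s) (sys.B q *ᵥ u.1 (s.toNNReal + τ))) ht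
    (u.finite_discontinuities τ t).countable
    (((sys.continuous_flow q).comp hθ).continuousOn.clm_apply hξ.1)
    (fun s hs => sys.hasDerivAt_flow_sub_apply (v := fun s => u.1 (s.toNNReal + τ))
      (hξ.2 s hs.1 (not_not.1 fun h => hs.2 ⟨hs.1, h⟩)) t)
    (sys.intervalIntegrable_flow q u τ ht hθ)
  simp only [sub_self, sub_zero, flow_zero, one_apply_eq_self] at h
  rw [step, h, add_sub_cancel]

theorem exists_isSolution (q : Q) (u : PC m) (τ : ℝ≥0) {t : ℝ} (ht : 0 ≤ t)
    (x : Fin n → ℝ) : ∃ ξ : ℝ → Fin n → ℝ, ξ 0 = x ∧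
      IsSolution (sys.A q) (sys.B q) (fun s => u.1 (s.toNNReal + τ)) t ξ := by
  let g : ℝ → Fin n → ℝ := fun s => sys.flow q (-s) (sys.B q *ᵥ u.1 (s.toNNReal + τ))
  have hg : ∀ {r : ℝ}, 0 ≤ r → IntervalIntegrable g volume 0 r := fun hr =>
    sys.intervalIntegrable_flow q u τ hr continuous_neg
  refine ⟨fun r => sys.flow q r (x + ∫ s in (0 : ℝ)..r, g s), by simp [flow_zero],
    (sys.continuous_flow q).continuousOn.clm_apply (continuousOn_const.add ?_), fun s hs hc => ?_⟩
  · rw [← uIcc_of_le ht]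
    refine intervalIntegral.continuousOn_primitive_interval ?_
    rw [uIcc_of_le ht, integrableOn_Icc_iff_integrableOn_Ioc]
    exact (intervalIntegrable_iff_integrableOn_Ioc_of_le ht).1 (hg ht)
  · have hgc : ContinuousAt g s :=
      ((sys.continuous_flow q).comp continuous_neg).continuousAt.clm_apply
        ((mulVecCLM (sys.B q)).continuous.continuousAt.comp hc)
    have hprim : HasDerivAt (fun r => ∫ s in (0 : ℝ)..r, g s) (g s) s :=
      intervalIntegral.integral_hasDerivAt_right (hg hs.1.le)
        ⟨Ioo 0 t, Ioo_mem_nhds hs.1 hs.2,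
          ((intervalIntegrable_iff_integrableOn_Ioo_of_le ht).1 (hg ht)).aestronglyMeasurable⟩ hgc
    have hinv : sys.flow q s (g s) = sys.B q *ᵥ u.1 (s.toNNReal + τ) := by
      change (sys.flow q s * sys.flow q (-s)) _ = _
      rw [← flow_add, add_neg_cancel, flow_zero, one_apply_eq_self]
    exact ((sys.hasDerivAt_flow q s).clm_apply (hprim.const_add x)).congr_deriv
      (congrArg₂ (· + ·) rfl hinv)

/-- The state reached from `x` along a switching sequence which starts at time `τ`. -/
noncomputable def stateMap (u : PC m) : ℝ≥0 → (Fin n → ℝ) → List (Q × ℝ≥0) → (Fin n → ℝ)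
  | _, x, [] => x
  | τ, x, (q, t) :: w => stateMap u (τ + t) (sys.step q u τ t x) w

theorem isState_iff (u : PC m) (τ : ℝ≥0) (x₀ : Fin n → ℝ) (w : List (Q × ℝ≥0))
    (x : Fin n → ℝ) : sys.IsState u τ x₀ w x ↔ x = sys.stateMap u τ x₀ w := by
  induction w generalizing τ x₀ with
  | nil => rfl
  | cons y w ih =>
    obtain ⟨q, t⟩ := y
    simp only [IsState, stateMap, ih]
    constructor
    · rintro ⟨ξ, rfl, hξ, rfl⟩
      rw [sys.eq_step_of_isSolution t.coe_nonneg hξ]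
    · rintro rfl
      obtain ⟨ξ, rfl, hξ⟩ := sys.exists_isSolution q u τ t.coe_nonneg x₀
      exact ⟨ξ, rfl, hξ, by rw [sys.eq_step_of_isSolution t.coe_nonneg hξ]⟩

variable {E : Type*} [NormedAddCommGroup E] [NormedSpace ℝ E] [CompleteSpace E]

theorem apply_trans_step (L : (Fin n → ℝ) →L[ℝ] E) (q : Q) (u : PC m) (τ t : ℝ≥0)
    (x : Fin n → ℝ) (w : List (Q × ℝ≥0)) :
    L (sys.trans w (sys.step q u τ t x)) = L (sys.trans ((q, t) :: w) x) +
      ∫ s in (0 : ℝ)..t, L (sys.trans ((q, ((t : ℝ) - s).toNNReal) :: w)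
        (sys.B q *ᵥ u.1 (s.toNNReal + τ))) := by
  have hcomm := (L ∘L sys.trans w).intervalIntegral_comp_comm
    (sys.intervalIntegrable_flow q u τ t.coe_nonneg (θ := fun s => t - s) (by fun_prop))
  rw [step, map_add, map_add]
  refine congrArg _ (hcomm.symm.trans (intervalIntegral.integral_congr fun s hs => ?_))
  rw [uIcc_of_le t.coe_nonneg] at hs
  simp only [trans, Real.coe_toNNReal _ (sub_nonneg.2 hs.2)]
  rfl

theorem apply_stateMap (L : (Fin n → ℝ) →L[ℝ] E) (u : PC m) (τ : ℝ≥0) (x : Fin n → ℝ)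
    (w : List (Q × ℝ≥0)) : L (sys.stateMap u τ x w) = L (sys.trans w x) +
      kernelInt (fun q v => L ∘L sys.trans v ∘L mulVecCLM (sys.B q)) u.1 τ w := by
  induction w generalizing τ x with
  | nil => simp [stateMap, trans, kernelInt]
  | cons y w ih =>
    obtain ⟨q, t⟩ := y
    rw [stateMap, ih, apply_trans_step, kernelInt, add_assoc]
    rfl

/-- The input-output map `y_Σ(x, ·, ·)` of a linear switched system started in `x`. -/
noncomputable def ioMap (x : Fin n → ℝ) : IOMap Q m p := fun u w =>
  sys.C (w.1.getLast w.2).1 *ᵥ sys.stateMap u 0 x w.1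

theorem isOutput_iff (x : Fin n → ℝ) (u : PC m) (w : SwitchSeq Q) (y : Fin p → ℝ) :
    sys.IsOutput x u w y ↔ y = sys.ioMap x u w := by
  simp only [IsOutput, isState_iff, exists_eq_left, ioMap]

theorem hasKernels_ioMap (x : Fin n → ℝ) : HasKernels (sys.ioMap x)
    (fun q v => mulVecCLM (sys.C q) (sys.trans v x))
    (fun q q₀ v => mulVecCLM (sys.C q) ∘L sys.trans v ∘L mulVecCLM (sys.B q₀)) where
  init q := sys.isWordKernel_apply_trans _ x
  input q q₀ e := sys.isWordKernel_apply_trans (mulVecCLM (sys.C q)) (sys.B q₀ *ᵥ e)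
  apply_append u v q t := by
    refine Eq.trans ?_ (sys.apply_stateMap (mulVecCLM (sys.C q)) u 0 x (v ++ [(q, t)]))
    simp only [ioMap, List.getLast_append_singleton, mulVecCLM_apply]

theorem markovInit_ioMap (x : Fin n → ℝ) (q : Q) (w : List Q) :
    markovInit (sys.ioMap x) q w = (sys.C q * sys.prodA w) *ᵥ x := by
  rw [(sys.hasKernels_ioMap x).markovInit_eq, wordCoeff_apply_trans, mulVecCLM_apply,
    Matrix.mulVec_mulVec]

theorem markovInputOf_ioMap (x : Fin n → ℝ) (q q₀ : Q) (j : Fin m) (w : List Q) :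
    markovInputOf (sys.ioMap x) q q₀ j w =
      (sys.C q * sys.prodA w * sys.B q₀) *ᵥ Pi.single j 1 := by
  rw [(sys.hasKernels_ioMap x).markovInputOf_eq, ← Matrix.mulVec_mulVec, ← Matrix.mulVec_mulVec]
  exact sys.wordCoeff_apply_trans (mulVecCLM (sys.C q)) _ w

end LSS

end Solutions

/-! ### Realizations and Markov parameters -/

section RealizationMarkov

variable {Q : Type*} {m p n : ℕ} {Φ : Set (IOMap Q m p)}

theorem HasKernelRepresentation.markovInput_eq (hΦ : HasKernelRepresentation Φ) (f : Φ) (q q₀ : Q)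
    (j : Fin m) (w : List Q) : markovInput Φ q q₀ j w = markovInputOf f.1 q q₀ j w := by
  have hne : Φ.Nonempty := ⟨f.1, f.2⟩
  obtain ⟨G, hG⟩ := hΦ.exists_hasKernels
  obtain ⟨K, hK⟩ := hG f
  obtain ⟨K', hK'⟩ := hG ⟨hne.some, hne.some_mem⟩
  rw [markovInput, dif_pos hne, hK.markovInputOf_eq]
  exact hK'.markovInputOf_eq q q₀ j w

namespace Realization

theorem isRealization_iff {Z : Realization Φ n} :
    Z.IsRealization ↔ ∀ f : Φ, f.1 = Z.sys.ioMap (Z.μ f) := by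
  simp only [IsRealization, LSS.isOutput_iff, funext_iff]

theorem IsRealization.exists_isPartialRealization {Z : Realization Φ n} (hZ : Z.IsRealization) :
    ∃ Z' : Realization Φ n, ∀ M, Z'.IsPartialRealization M := by
  rw [isRealization_iff] at hZ
  rcases Φ.eq_empty_or_nonempty with rfl | hne
  · -- the input Markov parameters of the empty set vanish by convention, so `B` has to be replaced
    refine ⟨⟨⟨Z.sys.A, 0, Z.sys.C⟩, Z.μ⟩, fun M q w _ => ⟨fun q₀ j => ?_, fun f => f.2.elim⟩⟩
    simp only [markovInput, Set.not_nonempty_empty, dite_false, Pi.zero_apply, Matrix.mul_zero,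
      Matrix.zero_mulVec]
  · refine ⟨Z, fun M q w _ => ⟨fun q₀ j => ?_, fun f => ?_⟩⟩
    · have hsome : hne.some = Z.sys.ioMap _ := hZ ⟨_, hne.some_mem⟩
      rw [markovInput, dif_pos hne, hsome, LSS.markovInputOf_ioMap]
    · rw [hZ f, LSS.markovInit_ioMap]

theorem isRealization_of_isPartialRealization (hΦ : HasKernelRepresentation Φ)
    {Z : Realization Φ n} (hZ : ∀ M, Z.IsPartialRealization M) : Z.IsRealization := by
  obtain ⟨G, hG⟩ := hΦ.exists_hasKernels
  refine isRealization_iff.2 fun f => ?_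
  obtain ⟨K, hK⟩ := hG f
  refine hK.eq_of_markov_eq (Z.sys.hasKernels_ioMap (Z.μ f)) (fun q w => ?_) fun q q₀ j w => ?_
  · rw [LSS.markovInit_ioMap, (hZ w.length q w le_rfl).2 f]
  · rw [LSS.markovInputOf_ioMap, ← hΦ.markovInput_eq f, (hZ w.length q w le_rfl).1 q₀ j]

theorem IsPartialRealization.isMinimalRealization {N : ℕ} {Z : Realization Φ n}
    (h : Z.IsPartialRealization (2 * N + 1)) (hΦ : HasKernelRepresentation Φ)
    (hn : (hankelSub Φ N N).eRank = n) (hH : (hankel Φ).eRank = n) : Z.IsMinimalRealization := by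
  refine ⟨isRealization_of_isPartialRealization hΦ (h.of_eRank_eq hn hH), fun k Z' hZ' => ?_⟩
  obtain ⟨Z₁, hZ₁⟩ := hZ'.exists_isPartialRealization
  exact_mod_cast hH ▸ eRank_hankel_le hZ₁

end Realization

theorem IsFullRankFactorization.exists_isMinimalRealization {N r : ℕ}
    {O : Matrix (Words Q (N + 1) × (Q × Fin p)) (Fin r) ℝ}
    {R : Matrix (Fin r) (Words Q N × ColIdx Φ) ℝ} (hOR : IsFullRankFactorization O R)
    (hΦ : HasKernelRepresentation Φ) (hH : (hankelSub Φ N N).eRank = (hankel Φ).eRank) :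
    ∃ Z : Realization Φ r, factorizationAlgorithm O R = some Z ∧ Z.IsMinimalRealization := by
  have hrank := rankCondition_of_eRank_eq hH
  obtain ⟨Z, hZ, hout⟩ := hOR.exists_isFactorizationOutput hrank
  have hr := hOR.eRank_hankelSub_eq hrank
  exact ⟨Z, hZ, (hout.isPartialRealization hOR hrank).isMinimalRealization hΦ hr (hH ▸ hr)⟩

theorem Realization.IsRealization.eRank_hankelSub_eq {N : ℕ} {Z : Realization Φ n}
    (hZ : Z.IsRealization) (hn : n ≤ N + 1) : (hankelSub Φ N N).eRank = (hankel Φ).eRank := by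
  obtain ⟨Z', hZ'⟩ := hZ.exists_isPartialRealization
  exact eRank_hankelSub_eq_eRank_hankel hZ' hn

end RealizationMarkov

end LinSwitch

theorem theorem3 {Q : Type*} [Finite Q] {m p : ℕ} (Φ : Set (LinSwitch.IOMap Q m p))
    (hΦ : LinSwitch.HasKernelRepresentation Φ) (N : ℕ) (hN : 0 < N) :
    -- both algorithms can be started
    (∃ (r : ℕ) (O : Matrix (LinSwitch.Words Q (N + 1) × (Q × Fin p)) (Fin r) ℝ)
      (R : Matrix (Fin r) (LinSwitch.Words Q N × LinSwitch.ColIdx Φ) ℝ),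
      LinSwitch.IsFullRankFactorization O R) ∧
    (∃ n : ℕ, Nonempty (LinSwitch.colSpace Φ N ≃ₗ[ℝ] (Fin n → ℝ))) ∧
    -- partial realization
    (LinSwitch.RankCondition Φ N →
      ∀ (r : ℕ) (O : Matrix (LinSwitch.Words Q (N + 1) × (Q × Fin p)) (Fin r) ℝ)
        (R : Matrix (Fin r) (LinSwitch.Words Q N × LinSwitch.ColIdx Φ) ℝ),
        LinSwitch.IsFullRankFactorization O R →
        ∃ Z : LinSwitch.Realization Φ r,
          LinSwitch.factorizationAlgorithm O R = some Z ∧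
          Z.IsMinimalPartialRealization (2 * N + 1) ∧
          ∀ (n : ℕ) (S : LinSwitch.colSpace Φ N ≃ₗ[ℝ] (Fin n → ℝ)),
            (∃ Z' : LinSwitch.Realization Φ n, LinSwitch.IsColumnSpaceOutput Φ N S Z') ∧
            ∀ Z' : LinSwitch.Realization Φ n, LinSwitch.IsColumnSpaceOutput Φ N S Z' →
              Z.Isomorphic Z') ∧
    -- complete realization
    ((LinSwitch.hankelSub Φ N N).eRank = (LinSwitch.hankel Φ).eRank →
      LinSwitch.RankCondition Φ N ∧
      ∀ (r : ℕ) (O : Matrix (LinSwitch.Words Q (N + 1) × (Q × Fin p)) (Fin r) ℝ)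
        (R : Matrix (Fin r) (LinSwitch.Words Q N × LinSwitch.ColIdx Φ) ℝ),
        LinSwitch.IsFullRankFactorization O R →
        ∃ Z : LinSwitch.Realization Φ r,
          LinSwitch.factorizationAlgorithm O R = some Z ∧ Z.IsMinimalRealization) ∧
    -- a realization of dimension at most `N + 1` exists
    ((∃ (n : ℕ) (Z₀ : LinSwitch.Realization Φ n), n ≤ N + 1 ∧ Z₀.IsRealization) →
      (LinSwitch.hankelSub Φ N N).eRank = (LinSwitch.hankel Φ).eRank ∧
      ∀ (r : ℕ) (O : Matrix (LinSwitch.Words Q (N + 1) × (Q × Fin p)) (Fin r) ℝ)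
        (R : Matrix (Fin r) (LinSwitch.Words Q N × LinSwitch.ColIdx Φ) ℝ),
        LinSwitch.IsFullRankFactorization O R →
        ∃ Z : LinSwitch.Realization Φ r,
          LinSwitch.factorizationAlgorithm O R = some Z ∧ Z.IsMinimalRealization) := by
  have : Finite (LinSwitch.Words Q N) := (List.finite_length_le Q N).to_subtype
  refine ⟨LinSwitch.exists_isFullRankFactorization Φ N,
    ⟨_, ⟨(Module.finBasis ℝ (LinSwitch.colSpace Φ N)).equivFun⟩⟩, fun hrank r O R hOR => ?_,
    fun hH => ⟨LinSwitch.rankCondition_of_eRank_eq hH,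
      fun r O R hOR => hOR.exists_isMinimalRealization hΦ hH⟩, ?_⟩
  · obtain ⟨Z, hZ, hout⟩ := hOR.exists_isFactorizationOutput hrank
    have hpartial := hout.isPartialRealization hOR hrank
    have hr := hOR.eRank_hankelSub_eq hrank
    exact ⟨Z, hZ, hpartial.isMinimalPartialRealization (by omega) hr, fun n S =>
      ⟨(hpartial.exists_isColumnSpaceOutput hrank hr S).imp fun _ h => h.1,
        fun _ => hpartial.isomorphic_of_isColumnSpaceOutput hrank hr⟩⟩
  · rintro ⟨n, Z₀, hn, hZ₀⟩
    have hH := hZ₀.eRank_hankelSub_eq hn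
    exact ⟨hH, fun r O R hOR => hOR.exists_isMinimalRealization hΦ hH⟩
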